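/- Let $1<p<\infty$ and let $L^p[0,1]$ be the complex $L^p$-space of $[0,1]$ with Lebesgue measure. A bounded linear operator $T$ on $L^p[0,1]$ is called positive if $Tf\ge 0$ whenever $f\ge 0$. Let $\mathcal{C}_p$, $\mathcal{I}_p$ and $\mathcal{U}_p$ be the sets of positive contractions (that is, $\|T\|\le 1$), positive linear isometries, and positive invertible (that is, surjective) linear isometries of $L^p[0,1]$, respectively. Write $T^*\varphi=\varphi\circ T$ for the adjoint of $T$ on the dual space $(L^p[0,1])^*\cong L^{p'}[0,1]$, where $\frac1p+\frac1{p'}=1$. Let $\mathrm{WOT}$, $\mathrm{SOT}$ and $\mathrm{SOT}^*$ be the coarsest topologies on the bounded operators for which, respectively, the following maps are continuous: all maps $T\mapsto\varphi(Tf)$; all maps $T\mapsto Tf$ into $L^p[0,1]$ with its norm; all maps $T\mapsto Tf$ and $T\mapsto T^*\varphi$ into $L^p[0,1]$ and $(L^p[0,1])^*$ with their norms. Here $f$ ranges over $L^p[0,1]$ and $\varphi$ over $(L^p[0,1])^*$. Endow $\mathcal{C}_p$ with the corresponding subspace topologies, and for two of these topologies $\tau_1,\tau_2$ let $\mathrm{Cont}_p(\tau_1,\tau_2)\subseteq\mathcal{C}_p$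 be the set of points of continuity of the identity map $(\mathcal{C}_p,\tau_1)\to(\mathcal{C}_p,\tau_2)$. Then $$\mathrm{Cont}_p(\mathrm{WOT},\mathrm{SOT})=\mathcal{I}_p\qquad\text{and}\qquad \mathrm{Cont}_p(\mathrm{WOT},\mathrm{SOT}^*)=\mathcal{U}_p.$$ In particular, $\mathcal{I}_p$ and $\mathcal{U}_p$ are dense $G_\delta$ subsets of $(\mathcal{C}_p,\mathrm{WOT})$. -/

import Mathlib

open MeasureTheory
open scoped ENNReal ComplexOrder

namespace PosOp

/-- The complex Banach space `L^p[0,1]` with respect to Lebesgue measure. -/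
abbrev LpI (p : ℝ≥0∞) : Type := Lp ℂ p (volume : Measure unitInterval)

section

variable (p : ℝ≥0∞) [Fact (1 ≤ p)]

/-- Bounded linear operators on the complex space `L^p[0,1]`. -/
abbrev Op : Type := LpI p →L[ℂ] LpI p

variable {p} in
/-- `T` is positive: it maps (a.e.) non-negative functions to (a.e.) non-negative functions.
The order on `ℂ` is the usual one: `0 ≤ z` iff `z` is real and non-negative. -/
def IsPositive (T : Op p) : Prop :=
  ∀ f : LpI p, (∀ᵐ x, 0 ≤ f x) → ∀ᵐ x, 0 ≤ T f x

/-- `C_p`: the positive contractions. -/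
def positiveContractions : Set (Op p) := {T | IsPositive T ∧ ∀ f, ‖T f‖ ≤ ‖f‖}

/-- `I_p`: the positive (not necessarily surjective) linear isometries. -/
def positiveIsometries : Set (Op p) := {T | IsPositive T ∧ ∀ f, ‖T f‖ = ‖f‖}

/-- `U_p`: the positive invertible linear isometries. -/
def positiveInvertibleIsometries : Set (Op p) :=
  {T | IsPositive T ∧ (∀ f, ‖T f‖ = ‖f‖) ∧ Function.Surjective T}

/-- The Banach space adjoint `T* : (L^p)* → (L^p)*`, `T* φ = φ ∘ T`. -/
noncomputable def adj (T : Op p) (φ : StrongDual ℂ (LpI p)) : StrongDual ℂ (LpI p) := φ ∘L T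

/-- The weak operator topology: the coarsest topology on the operators making `T ↦ φ (T f)`
continuous for all `f ∈ L^p` and all `φ ∈ (L^p)*`. -/
@[reducible] noncomputable def wot : TopologicalSpace (Op p) :=
  TopologicalSpace.induced (fun T (q : LpI p × StrongDual ℂ (LpI p)) => q.2 (T q.1)) inferInstance

/-- The strong operator topology: the coarsest topology making `T ↦ T f` norm continuous for all
`f ∈ L^p`. -/
@[reducible] noncomputable def sot : TopologicalSpace (Op p) :=
  TopologicalSpace.induced (fun T (f : LpI p) => T f) inferInstance

/-- The strong operator topology on the adjoints: the coarsest topology making `T ↦ T* φ`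
norm continuous for all `φ ∈ (L^p)*`. -/
@[reducible] noncomputable def sotAdj : TopologicalSpace (Op p) :=
  TopologicalSpace.induced (fun T (φ : StrongDual ℂ (LpI p)) => adj p T φ) inferInstance

/-- The strong* operator topology: the coarsest topology making `T ↦ T f` and `T ↦ T* φ`
norm continuous for all `f ∈ L^p` and `φ ∈ (L^p)*`
(the infimum in the lattice of topologies is the join of the families of open sets). -/
@[reducible] noncomputable def sotStar : TopologicalSpace (Op p) := sot p ⊓ sotAdj p

variable {p} in
/-- The subspace topology on `C_p` of a topology on the operators. -/
@[reducible] noncomputable def onC (τ : TopologicalSpace (Op p)) : TopologicalSpace (positiveContractions p) :=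
  TopologicalSpace.induced Subtype.val τ

variable {p} in
/-- `Cont_p(τ₁, τ₂)`: the points of continuity of the identity map `(C_p, τ₁) → (C_p, τ₂)`. -/
def contPoints (τ₁ τ₂ : TopologicalSpace (Op p)) : Set (Op p) :=
  {T | ∃ hT : T ∈ positiveContractions p,
    @ContinuousAt (positiveContractions p) (positiveContractions p) (onC τ₁) (onC τ₂) id ⟨T, hT⟩}

variable {p} in
/-- The set `A` is contained in `C_p` and is a dense `G_δ` subset of the space `(C_p, τ)`. -/
def IsDenseGδIn (τ : TopologicalSpace (Op p)) (A : Set (Op p)) : Prop :=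
  A ⊆ positiveContractions p ∧
    @Dense (positiveContractions p) (onC τ) (Subtype.val ⁻¹' A) ∧
    @IsGδ (positiveContractions p) (onC τ) (Subtype.val ⁻¹' A)

end

end PosOp

namespace PosOp

open Filter Topology Set

/-! ### Uniform convexity and smoothness of `‖·‖ ^ q` on `ℂ` -/

section Convexity

variable {q : ℝ}

/-! Contractions that converge weakly to an isometry `T` satisfy `‖S f‖ ≤ ‖T f‖`, so uniform
convexity of `L^p` turns weak convergence of `S f` into norm convergence
(`tendsto_of_weak_of_norm_le`). If `T` is also onto, `φ ↦ φ ∘ T` is isometric on the dual. The dual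
counterpart of that argument is drawn from uniform smoothness of `L^p` itself, without identifying
the dual (`tendsto_comp_of_weak`).

The converse inclusions rest on weak density of the invertible isometries (`exists_tendsto_weak`).
At a continuity point the approximating isometries converge strongly, so the limit is isometric. If
their adjoints converge strongly too, the adjoint of the limit does not decrease norms, and
Hahn-Banach gives surjectivity.

For density, mix `T` with `0` and the mean so that it has norm below 1 and strictly positive matrix
entries `a i j` relative to a partition of `[0,1]`. Maximising the `ℓ^q` norm of `a z`, with `q =
p.toReal`, yields positive vectors `x`, `y` with `a x < y` and `aᵀ y^(q-1) < x^(q-1)`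
(`exists_strict_subinvariant`). These vectors dictate how to cut each piece twice, once as part of
the range and once as part of the domain, so that sending subpiece `(j, i)` of the domain to
subpiece `(i, j)` of the range reproduces the entry `a i j` exactly. The leftover parts are matched
by an isometry whose contribution is negligible (`exists_approx`). Hence the isometry and `T` have
almost the same compression to step functions; refining the partition gives weak convergence.

The `G_δ` claims follow from separability of `L^p`, weak lower semicontinuity of the norm, and the
continuity already proved at isometries. -/

theorem norm_half_add_rpow_lt (hq : 1 < q) {a b : ℂ} (hab : a ≠ b) :
    ‖(a + b) / 2‖ ^ q < (‖a‖ ^ q + ‖b‖ ^ q) / 2 := by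
  have h2 : ‖(a + b) / 2‖ = ‖a + b‖ / 2 := by simp
  rw [h2]
  by_cases h : ‖a‖ = ‖b‖
  · have h1 : ‖a + b‖ < ‖a‖ + ‖b‖ :=
      norm_add_lt_of_not_sameRay fun hr => hab ((sameRay_iff_of_norm_eq h).1 hr)
    rw [← h] at h1 ⊢
    have : (‖a + b‖ / 2) ^ q < ‖a‖ ^ q :=
      Real.rpow_lt_rpow (by positivity) (by linarith) (by linarith)
    linarith
  · have h1 := (strictConvexOn_rpow hq).2 (mem_Ici.2 (norm_nonneg a)) (mem_Ici.2 (norm_nonneg b)) h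
      (show (0 : ℝ) < 1 / 2 by norm_num) (show (0 : ℝ) < 1 / 2 by norm_num) (by norm_num)
    simp only [smul_eq_mul] at h1
    have h3 : (‖a + b‖ / 2) ^ q ≤ (1 / 2 * ‖a‖ + 1 / 2 * ‖b‖) ^ q :=
      Real.rpow_le_rpow (by positivity) (by linarith [norm_add_le a b]) (by linarith)
    linarith

theorem norm_half_add_rpow_le (hq : 1 < q) (a b : ℂ) :
    ‖(a + b) / 2‖ ^ q ≤ (‖a‖ ^ q + ‖b‖ ^ q) / 2 := by
  by_cases h : a = b
  · subst h; simp
  · exact (norm_half_add_rpow_lt hq h).le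

/-- Both sides are homogeneous of degree `q`, so the unit sphere of `ℂ × ℂ` suffices. Where the `ε`
term alone is not strictly enough, `a ≠ b`, and the convexity gap has a positive minimum by
compactness. -/
theorem exists_norm_sub_rpow_le (hq : 1 < q) {ε : ℝ} (hε : 0 < ε) :
    ∃ C : ℝ, 0 ≤ C ∧ ∀ a b : ℂ, ‖a - b‖ ^ q ≤ ε * (‖a‖ ^ q + ‖b‖ ^ q) +
      C * ((‖a‖ ^ q + ‖b‖ ^ q) / 2 - ‖(a + b) / 2‖ ^ q) := by
  have hq0 : 0 ≤ q := by linarith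
  have cont : Continuous fun x : ℂ => ‖x‖ ^ q :=
    continuous_norm.rpow_const fun _ => Or.inr hq0
  set gap : ℂ × ℂ → ℝ := fun z => (‖z.1‖ ^ q + ‖z.2‖ ^ q) / 2 - ‖(z.1 + z.2) / 2‖ ^ q with hgap
  have cgap : Continuous gap :=
    (((cont.comp continuous_fst).add (cont.comp continuous_snd)).div_const 2).sub
      (cont.comp ((continuous_fst.add continuous_snd).div_const 2))
  set K : Set (ℂ × ℂ) := Metric.sphere 0 1 ∩
    {z | ε * (‖z.1‖ ^ q + ‖z.2‖ ^ q) ≤ ‖z.1 - z.2‖ ^ q} with hK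
  have hKc : IsCompact K := (isCompact_sphere 0 1).inter_right <| isClosed_le
    (((cont.comp continuous_fst).add (cont.comp continuous_snd)).const_mul ε)
    (cont.comp (continuous_fst.sub continuous_snd))
  have hpos : ∀ z ∈ K, 0 < gap z := by
    rintro ⟨a, b⟩ ⟨h1, h2⟩
    have hab : a ≠ b := by
      rintro rfl
      simp only [mem_ofPred_eq, sub_self, norm_zero] at h2
      rw [Real.zero_rpow (by linarith)] at h2
      have h0 : ‖a‖ = 1 := by simpa [Prod.norm_def] using h1
      rw [h0, Real.one_rpow] at h2
      linarith
    exact sub_pos.2 (norm_half_add_rpow_lt hq hab)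
  obtain ⟨c, hc, hcK⟩ : ∃ c > 0, ∀ z ∈ K, c ≤ gap z := by
    rcases K.eq_empty_or_nonempty with h | h
    · exact ⟨1, one_pos, by simp [h]⟩
    · obtain ⟨z, hz, hmin⟩ := hKc.exists_isMinOn h cgap.continuousOn
      exact ⟨gap z, hpos z hz, fun w hw => hmin hw⟩
  have key : ∀ a b : ℂ, ‖(a, b)‖ = 1 → ‖a - b‖ ^ q ≤ ε * (‖a‖ ^ q + ‖b‖ ^ q) +
      -- On the sphere the left side is at most `2 ^ q`, while the gap is at least `c` on `K`; hence
      -- the constant `2 ^ q / c`.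
      (2 ^ q / c) * ((‖a‖ ^ q + ‖b‖ ^ q) / 2 - ‖(a + b) / 2‖ ^ q) := by
    intro a b h
    by_cases hz : (a, b) ∈ K
    · have h1 := hcK _ hz
      have h2 : ‖a - b‖ ^ q ≤ 2 ^ q := by
        refine Real.rpow_le_rpow (norm_nonneg _) ?_ hq0
        have := norm_fst_le (a, b)
        have := norm_snd_le (a, b)
        have := norm_sub_le a b
        simp only at *
        linarith
      have h3 : (2 : ℝ) ^ q = 2 ^ q / c * c := by field_simp
      have h4 : 2 ^ q / c * c ≤ 2 ^ q / c * gap (a, b) := by gcongr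
      have : 0 ≤ ε * (‖a‖ ^ q + ‖b‖ ^ q) := by positivity
      simp only [hgap] at h4
      linarith
    · have h1 : ‖a - b‖ ^ q < ε * (‖a‖ ^ q + ‖b‖ ^ q) := by
        by_contra hn
        exact hz ⟨by simpa using h, not_lt.1 hn⟩
      have h2 := sub_nonneg.2 (norm_half_add_rpow_le hq a b)
      have : 0 ≤ (2 ^ q / c) * ((‖a‖ ^ q + ‖b‖ ^ q) / 2 - ‖(a + b) / 2‖ ^ q) := by positivity
      linarith
  refine ⟨2 ^ q / c, by positivity, fun a b => ?_⟩
  by_cases h0 : (a, b) = 0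
  · obtain ⟨rfl, rfl⟩ := Prod.mk.inj h0
    simp [Real.zero_rpow (by linarith : q ≠ 0)]
  set r := ‖(a, b)‖ with hr
  have hr0 : 0 < r := norm_pos_iff.2 h0
  have hrc : (r : ℂ) ≠ 0 := by exact_mod_cast hr0.ne'
  have hn : ‖(a / r, b / r)‖ = 1 := by
    have : (a / r, b / r) = ((r : ℂ)⁻¹) • (a, b) := by
      simp [div_eq_inv_mul]
    rw [this, norm_smul, norm_inv, Complex.norm_real, Real.norm_of_nonneg hr0.le, ← hr,
      inv_mul_cancel₀ hr0.ne']
  have h := key _ _ hn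
  have hd : ∀ x : ℂ, ‖x / r‖ ^ q = ‖x‖ ^ q / r ^ q := fun x => by
    rw [norm_div, Complex.norm_real, Real.norm_of_nonneg hr0.le,
      Real.div_rpow (norm_nonneg _) hr0.le]
  rw [← sub_div, ← add_div, div_right_comm, hd, hd, hd, hd] at h
  have hrq : 0 < r ^ q := by positivity
  have := mul_le_mul_of_nonneg_right h hrq.le
  field_simp at this ⊢
  linarith

/-- For `q > 1` the function `‖·‖ ^ q` is `C¹`, so the first-order terms at `± t b` cancel. Strict
differentiability makes the error locally uniform, compactness of the unit disc makes `t` uniform,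
and homogeneity removes the bound on `a` and `b`. -/
theorem exists_norm_add_rpow_add_le (hq : 1 < q) {ε : ℝ} (hε : 0 < ε) :
    ∃ t : ℝ, 0 < t ∧ ∀ a b : ℂ, ‖a + t * b‖ ^ q + ‖a - t * b‖ ^ q ≤
      2 * ‖a‖ ^ q + ε * t * (‖a‖ ^ q + ‖b‖ ^ q) := by
  have hq0 : 0 ≤ q := by linarith
  have hC : ContDiff ℝ 1 fun x : ℂ => ‖x‖ ^ q := contDiff_norm_rpow hq
  have hloc : ∀ a : ℂ, ∃ δ > 0, ∀ x ∈ Metric.ball a δ, ∀ t : ℝ, 0 ≤ t → t < δ → ∀ b : ℂ, ‖b‖ ≤ 1 →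
      ‖x + t * b‖ ^ q + ‖x - t * b‖ ^ q ≤ 2 * ‖x‖ ^ q + ε * t := by
    intro a
    have h := (hC.contDiffAt (x := a)).hasStrictFDerivAt one_ne_zero
    have h1 := (hasStrictFDerivAt_iff_isLittleO.1 h).def (show 0 < ε / 2 by linarith)
    obtain ⟨δ, hδ, hb⟩ := Metric.eventually_nhds_iff_ball.1 h1
    refine ⟨δ / 2, by linarith, fun x hx t ht0 htδ b hb1 => ?_⟩
    have hx' : dist x a < δ / 2 := hx
    have htb : ‖(t : ℂ) * b‖ ≤ t := by
      rw [norm_mul, Complex.norm_real, Real.norm_of_nonneg ht0]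
      nlinarith
    have aux : ∀ y : ℂ, ‖y‖ ≤ t → |‖x + y‖ ^ q - ‖x‖ ^ q - fderiv ℝ (fun x : ℂ => ‖x‖ ^ q) a y|
        ≤ ε / 2 * t := by
      intro y hy
      have h2 := hb (x + y, x) (by
        rw [Metric.mem_ball, Prod.dist_eq, max_lt_iff]
        refine ⟨?_, by simp only; linarith⟩
        have : dist (x + y) x ≤ t := by simpa using hy
        have := dist_triangle (x + y) x a
        simp only
        linarith)
      simp only [add_sub_cancel_left, Real.norm_eq_abs] at h2
      exact h2.trans (by gcongr)
    have h3 := aux _ htb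
    have h4 := aux (-(t * b)) (by simpa using htb)
    rw [map_neg, ← sub_eq_add_neg] at h4
    have := (abs_le.1 h3).2
    have := (abs_le.1 h4).2
    linarith
  choose δ hδ hδ' using hloc
  obtain ⟨s, -, hs⟩ := (isCompact_closedBall (0 : ℂ) 1).elim_nhds_subcover
    (fun a => Metric.ball a (δ a)) fun a _ => Metric.ball_mem_nhds a (hδ a)
  obtain ⟨t, ht, hts⟩ : ∃ t > 0, ∀ a ∈ s, t < δ a := by
    rcases s.eq_empty_or_nonempty with rfl | hne
    · exact ⟨1, one_pos, by simp⟩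
    · obtain ⟨a, ha, hmin⟩ := s.exists_min_image δ hne
      exact ⟨δ a / 2, by linarith [hδ a], fun b hb => by linarith [hδ a, hmin b hb]⟩
  refine ⟨t, ht, fun a b => ?_⟩
  by_cases h0 : (a, b) = 0
  · obtain ⟨rfl, rfl⟩ := Prod.mk.inj h0
    simp [Real.zero_rpow (by linarith : q ≠ 0)]
  set r := ‖(a, b)‖ with hr
  have hr0 : 0 < r := norm_pos_iff.2 h0
  have hrc : (r : ℂ) ≠ 0 := by exact_mod_cast hr0.ne'
  have hrn : ‖(r : ℂ)‖ = r := by rw [Complex.norm_real, Real.norm_of_nonneg hr0.le]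
  have ha : ‖a / r‖ ≤ 1 := by
    rw [norm_div, hrn]; exact (div_le_one hr0).2 (norm_fst_le (a, b))
  have hb : ‖b / r‖ ≤ 1 := by
    rw [norm_div, hrn]; exact (div_le_one hr0).2 (norm_snd_le (a, b))
  obtain ⟨c, hc, hac⟩ := mem_iUnion₂.1 (hs (mem_closedBall_zero_iff.2 ha))
  have h := hδ' c _ hac t ht.le (hts c hc) _ hb
  have hd : ∀ x : ℂ, ‖x / r‖ ^ q = ‖x‖ ^ q / r ^ q := fun x => by
    rw [norm_div, hrn, Real.div_rpow (norm_nonneg _) hr0.le]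
  rw [← mul_div_assoc, ← sub_div, ← add_div, hd, hd, hd] at h
  have hrq : 0 < r ^ q := by positivity
  have h1 := mul_le_mul_of_nonneg_right h hrq.le
  have h2 : r ^ q ≤ ‖a‖ ^ q + ‖b‖ ^ q := by
    rcases max_choice ‖a‖ ‖b‖ with h | h
    · rw [hr, Prod.norm_def, h]; simp only [le_add_iff_nonneg_right]; positivity
    · rw [hr, Prod.norm_def, h]; simp only [le_add_iff_nonneg_left]; positivity
  have h3 : ε * t * r ^ q ≤ ε * t * (‖a‖ ^ q + ‖b‖ ^ q) := by gcongr
  field_simp at h1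
  linarith

end Convexity

/-! ### The pointwise inequalities integrated to `L^p` -/

section LpNorm

theorem one_lt_toReal {p : ℝ≥0∞} (hp : 1 < p) (hp' : p ≠ ∞) : 1 < p.toReal := by
  rw [← ENNReal.toReal_one]; exact (ENNReal.toReal_lt_toReal (by simp) hp').2 hp

variable {p : ℝ≥0∞} [Fact (1 ≤ p)]

theorem toReal_pos' (hp' : p ≠ ∞) : 0 < p.toReal :=
  ENNReal.toReal_pos (zero_lt_one.trans_le Fact.out).ne' hp'

theorem norm_rpow_eq_integral (hp' : p ≠ ∞) (f : LpI p) :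
    ‖f‖ ^ p.toReal = ∫ x, ‖f x‖ ^ p.toReal := by
  have hq := toReal_pos' hp'
  rw [Lp.norm_def, (Lp.memLp f).eLpNorm_eq_integral_rpow_norm (by aesop) hp',
    ENNReal.toReal_ofReal (by positivity), ← Real.rpow_mul (by positivity),
    inv_mul_cancel₀ hq.ne', Real.rpow_one]

theorem integrable_norm_rpow (hp' : p ≠ ∞) (f : LpI p) :
    Integrable (fun x => ‖f x‖ ^ p.toReal) :=
  (Lp.memLp f).integrable_norm_rpow (zero_lt_one.trans_le Fact.out).ne' hp'

theorem exists_norm_sub_rpow_le_Lp (hp : 1 < p) (hp' : p ≠ ∞) {ε : ℝ} (hε : 0 < ε) :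
    ∃ C : ℝ, 0 ≤ C ∧ ∀ f g : LpI p, ‖f - g‖ ^ p.toReal ≤
      ε * (‖f‖ ^ p.toReal + ‖g‖ ^ p.toReal) + C * ((‖f‖ ^ p.toReal + ‖g‖ ^ p.toReal) / 2 -
        ‖(2 : ℂ)⁻¹ • (f + g)‖ ^ p.toReal) := by
  obtain ⟨C, hC, h⟩ := exists_norm_sub_rpow_le (one_lt_toReal hp hp') hε
  refine ⟨C, hC, fun f g => ?_⟩
  simp only [norm_rpow_eq_integral hp']
  have i1 := integrable_norm_rpow hp' f
  have i2 := integrable_norm_rpow hp' g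
  have i3 := integrable_norm_rpow hp' ((2 : ℂ)⁻¹ • (f + g))
  have i4 : Integrable fun x => ‖f x‖ ^ p.toReal + ‖g x‖ ^ p.toReal := i1.add i2
  have i5 : Integrable fun x => (‖f x‖ ^ p.toReal + ‖g x‖ ^ p.toReal) / 2 -
    ‖((2 : ℂ)⁻¹ • (f + g) : LpI p) x‖ ^ p.toReal := (i4.div_const 2).sub i3
  rw [← integral_add i1 i2, ← integral_const_mul, ← integral_div,
    ← integral_sub (i4.div_const 2) i3, ← integral_const_mul,
    ← integral_add (i4.const_mul ε) (i5.const_mul C)]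
  refine integral_mono_ae (integrable_norm_rpow hp' _)
    ((i4.const_mul ε).add (i5.const_mul C)) ?_
  filter_upwards [Lp.coeFn_sub f g, Lp.coeFn_smul (2 : ℂ)⁻¹ (f + g), Lp.coeFn_add f g]
    with x h1 h2 h3
  have := h (f x) (g x)
  rw [h1, h2, Pi.smul_apply, h3, Pi.add_apply, smul_eq_mul, inv_mul_eq_div]
  exact this

theorem exists_norm_add_rpow_add_le_Lp (hp : 1 < p) (hp' : p ≠ ∞) {ε : ℝ} (hε : 0 < ε) :
    ∃ t : ℝ, 0 < t ∧ ∀ f g : LpI p, ‖f + (t : ℂ) • g‖ ^ p.toReal + ‖f - (t : ℂ) • g‖ ^ p.toReal ≤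
      2 * ‖f‖ ^ p.toReal + ε * t * (‖f‖ ^ p.toReal + ‖g‖ ^ p.toReal) := by
  obtain ⟨t, ht, h⟩ := exists_norm_add_rpow_add_le (one_lt_toReal hp hp') hε
  refine ⟨t, ht, fun f g => ?_⟩
  simp only [norm_rpow_eq_integral hp']
  have i1 := integrable_norm_rpow hp' f
  have i2 := integrable_norm_rpow hp' g
  have i3 := integrable_norm_rpow hp' (f + (t : ℂ) • g)
  have i4 := integrable_norm_rpow hp' (f - (t : ℂ) • g)
  have i5 : Integrable fun x => ‖f x‖ ^ p.toReal + ‖g x‖ ^ p.toReal := i1.add i2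
  rw [← integral_add i1 i2, ← integral_const_mul, ← integral_const_mul, ← integral_add i3 i4,
    ← integral_add (i1.const_mul 2) (i5.const_mul _)]
  refine integral_mono_ae (i3.add i4) ((i1.const_mul 2).add (i5.const_mul _)) ?_
  filter_upwards [Lp.coeFn_sub f ((t : ℂ) • g), Lp.coeFn_add f ((t : ℂ) • g),
    Lp.coeFn_smul (t : ℂ) g] with x h1 h2 h3
  have := h (f x) (g x)
  rw [h1, h2, Pi.add_apply, Pi.sub_apply, h3, Pi.smul_apply, smul_eq_mul]
  exact this

theorem exists_norm_add_add_norm_sub_le (hp : 1 < p) (hp' : p ≠ ∞) {ε : ℝ} (hε : 0 < ε) :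
    ∃ t : ℝ, 0 < t ∧ ∀ f g : LpI p, ‖f‖ ≤ 1 → ‖g‖ ≤ 1 →
      ‖f + (t : ℂ) • g‖ + ‖f - (t : ℂ) • g‖ ≤ 2 + ε * t := by
  have hq := one_lt_toReal hp hp'
  obtain ⟨t, ht, h⟩ := exists_norm_add_rpow_add_le_Lp hp hp' (half_pos hε)
  refine ⟨t, ht, fun f g hf hg => ?_⟩
  -- Bernoulli's inequality passes from `q`-th powers of norms back to the norms.
  have key : ∀ u : ℝ, 0 ≤ u → p.toReal * (u - 1) ≤ u ^ p.toReal - 1 := fun u hu => by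
    have := one_add_mul_self_le_rpow_one_add (s := u - 1) (by linarith) hq.le
    rw [add_sub_cancel] at this
    linarith
  have h1 := h f g
  have hf' : ‖f‖ ^ p.toReal ≤ 1 := Real.rpow_le_one (norm_nonneg _) hf (by linarith)
  have hg' : ‖g‖ ^ p.toReal ≤ 1 := Real.rpow_le_one (norm_nonneg _) hg (by linarith)
  have h2 := key _ (norm_nonneg (f + (t : ℂ) • g))
  have h3 := key _ (norm_nonneg (f - (t : ℂ) • g))
  have h4 : ε / 2 * t * (‖f‖ ^ p.toReal + ‖g‖ ^ p.toReal) ≤ ε / 2 * t * (1 + 1) := by gcongr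
  by_contra! hc
  have h5 : 0 < ε * t := by positivity
  have h6 : 1 * (‖f + (t : ℂ) • g‖ + ‖f - (t : ℂ) • g‖ - 2) <
      p.toReal * (‖f + (t : ℂ) • g‖ + ‖f - (t : ℂ) • g‖ - 2) := by
    gcongr
    linarith
  linarith

end LpNorm

/-! ### Weak convergence with norm control -/

section Limits

variable {p : ℝ≥0∞} [Fact (1 ≤ p)] {α : Type*} {l : Filter α}

/-- Weak convergence together with a bound on the norms by the norm of the limit implies norm
convergence in `L^p`. -/
theorem tendsto_of_weak_of_norm_le (hp : 1 < p) (hp' : p ≠ ∞) {u : α → LpI p} {f : LpI p}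
    (hu : ∀ᶠ i in l, ‖u i‖ ≤ ‖f‖)
    (hw : ∀ φ : StrongDual ℂ (LpI p), Tendsto (fun i => φ (u i)) l (𝓝 (φ f))) :
    Tendsto u l (𝓝 f) := by
  have hq := one_lt_toReal hp hp'
  have hq0 : 0 < p.toReal := by linarith
  -- A norming functional of `f` keeps the midpoints `(u i + f) / 2` from losing norm in the limit,
  -- so the convexity gap tends to zero.
  obtain ⟨φ, hφ, hφf⟩ := exists_dual_vector'' ℂ f
  have hmid : Tendsto (fun i => ‖φ ((2 : ℂ)⁻¹ • (u i + f))‖ ^ p.toReal) l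
      (𝓝 (‖f‖ ^ p.toReal)) := by
    have h1 : Tendsto (fun i => φ ((2 : ℂ)⁻¹ • (u i + f))) l (𝓝 (φ f)) := by
      have := (((hw φ).add_const (φ f)).const_mul (2 : ℂ)⁻¹)
      convert this using 2
      · simp [mul_add]
      · ring
    have h2 := h1.norm.rpow_const (p := p.toReal) (Or.inr hq0.le)
    rwa [hφf, RCLike.norm_ofReal, abs_norm] at h2
  rw [tendsto_iff_norm_sub_tendsto_zero]
  have key : Tendsto (fun i => ‖u i - f‖ ^ p.toReal) l (𝓝 0) := by
    rw [Metric.tendsto_nhds]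
    intro η hη
    set ε := η / (4 * (‖f‖ ^ p.toReal + 1)) with hε
    have hε0 : 0 < ε := by positivity
    obtain ⟨C, hC, hCf⟩ := exists_norm_sub_rpow_le_Lp hp hp' hε0
    have hev : ∀ᶠ i in l, ‖f‖ ^ p.toReal - η / (4 * (C + 1)) <
        ‖φ ((2 : ℂ)⁻¹ • (u i + f))‖ ^ p.toReal :=
      hmid.eventually (lt_mem_nhds (by linarith [show 0 < η / (4 * (C + 1)) by positivity]))
    filter_upwards [hu, hev] with i h1 h2
    have h3 := hCf (u i) f
    have h4 : ‖φ ((2 : ℂ)⁻¹ • (u i + f))‖ ^ p.toReal ≤ ‖(2 : ℂ)⁻¹ • (u i + f)‖ ^ p.toReal := by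
      refine Real.rpow_le_rpow (norm_nonneg _) ?_ hq0.le
      exact (φ.le_opNorm _).trans (mul_le_of_le_one_left (norm_nonneg _) hφ)
    have h5 : ‖u i‖ ^ p.toReal ≤ ‖f‖ ^ p.toReal :=
      Real.rpow_le_rpow (norm_nonneg _) h1 hq0.le
    rw [Real.dist_eq, sub_zero, abs_of_nonneg (by positivity)]
    have h6 : C * ((‖u i‖ ^ p.toReal + ‖f‖ ^ p.toReal) / 2 - ‖(2 : ℂ)⁻¹ • (u i + f)‖ ^ p.toReal)
        ≤ C * (η / (4 * (C + 1))) := mul_le_mul_of_nonneg_left (by linarith) hC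
    have h7 : C * (η / (4 * (C + 1))) ≤ η / 4 := by
      rw [← mul_div_assoc, div_le_div_iff₀ (by positivity) (by norm_num)]
      nlinarith
    have h8 : ε * (‖u i‖ ^ p.toReal + ‖f‖ ^ p.toReal) ≤ ε * (2 * (‖f‖ ^ p.toReal + 1)) := by
      gcongr; linarith
    have h9 : ε * (2 * (‖f‖ ^ p.toReal + 1)) = η / 2 := by
      rw [hε]; field_simp; ring
    linarith
  have := key.rpow_const (p := p.toReal⁻¹) (Or.inr (by positivity))
  rw [Real.zero_rpow (by positivity)] at this
  refine this.congr fun i => ?_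
  rw [← Real.rpow_mul (norm_nonneg _), mul_inv_cancel₀ hq0.ne', Real.rpow_one]

theorem exists_norm_le_one_re_gt (ψ : StrongDual ℂ (LpI p)) {c : ℝ} (hc : c < ‖ψ‖) :
    ∃ f : LpI p, ‖f‖ ≤ 1 ∧ c < (ψ f).re := by
  obtain ⟨f, hf, hcf⟩ : ∃ f : LpI p, ‖f‖ ≤ 1 ∧ c < ‖ψ f‖ := by
    by_contra! h
    rcases le_or_gt 0 c with h0 | h0
    · exact absurd (ContinuousLinearMap.opNorm_le_of_unit_norm h0 fun f hf => h f hf.le) (not_le.2 hc)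
    · have := h 0 (by simp)
      simp at this
      linarith
  obtain ⟨z, hz, hzf⟩ := Complex.exists_norm_eq_mul_self (ψ f)
  refine ⟨z • f, by rwa [norm_smul, hz, one_mul], ?_⟩
  rw [map_smul, smul_eq_mul, ← hzf, Complex.ofReal_re]
  exact hcf

end Limits

/-! ### Norm convergence of adjoints, and surjectivity by duality -/

section Adjoint

variable {p : ℝ≥0∞} [Fact (1 ≤ p)] {α : Type*} {l : Filter α}

/-- Choose `f` in the unit ball almost norming `φ ∘ T`; eventually it almost norms `φ ∘ u i` as
well. For `g` in the unit ball, add the bounds on `re φ (T (f + t g))` and `re φ (u i (f - t g))`.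
Smoothness limits the sum of the two norms to `2 + ε t`, so `t · re (φ ∘ T - φ ∘ u i) g` is at most
`(M + 2) ε t`. -/
theorem tendsto_comp_of_weak (hp : 1 < p) (hp' : p ≠ ∞) {u : α → Op p} {T : Op p}
    (hu : ∀ i f, ‖u i f‖ ≤ ‖f‖) (φ : StrongDual ℂ (LpI p)) (hT : ‖φ‖ ≤ ‖φ ∘L T‖)
    (hTc : ∀ f, ‖T f‖ ≤ ‖f‖)
    (hw : ∀ f, Tendsto (fun i => φ (u i f)) l (𝓝 (φ (T f)))) :
    Tendsto (fun i => φ ∘L u i) l (𝓝 (φ ∘L T)) := by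
  rw [Metric.tendsto_nhds]
  intro η hη
  set M := ‖φ‖ with hM
  have hM0 : 0 ≤ M := norm_nonneg φ
  set ε := η / (2 * (M + 2)) with hε
  have hε0 : 0 < ε := by positivity
  obtain ⟨t, ht, htf⟩ := exists_norm_add_add_norm_sub_le hp hp' hε0
  have hεt : 0 < ε * t := by positivity
  obtain ⟨f, hf, hψf⟩ := exists_norm_le_one_re_gt (φ ∘L T) (c := M - ε * t) (by linarith)
  rw [ContinuousLinearMap.comp_apply] at hψf
  have hev : ∀ᶠ i in l, M - ε * t < (φ (u i f)).re :=
    ((Complex.continuous_re.tendsto _).comp (hw f)).eventually (lt_mem_nhds hψf)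
  filter_upwards [hev] with i hi
  rw [dist_comm, dist_eq_norm]
  have hre : ∀ (S : Op p) (h : LpI p), (∀ f, ‖S f‖ ≤ ‖f‖) → (φ (S h)).re ≤ M * ‖h‖ :=
    fun S h hS => (Complex.re_le_norm _).trans <| (φ.le_opNorm _).trans <| by
      gcongr; exact hS h
  have hle : ‖φ ∘L T - φ ∘L u i‖ ≤ (M + 2) * ε := by
    by_contra! hc
    obtain ⟨g, hg, hgc⟩ := exists_norm_le_one_re_gt _ hc
    simp only [_root_.sub_apply, ContinuousLinearMap.comp_apply,
      Complex.sub_re] at hgc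
    have h1 := hre T (f + (t : ℂ) • g) hTc
    have h2 := hre (u i) (f - (t : ℂ) • g) (hu i)
    simp only [map_add, map_sub, map_smul, smul_eq_mul, Complex.add_re, Complex.sub_re,
      Complex.re_ofReal_mul] at h1 h2
    have h3 : M * (‖f + (t : ℂ) • g‖ + ‖f - (t : ℂ) • g‖) ≤ M * (2 + ε * t) := by
      exact mul_le_mul_of_nonneg_left (htf f g hf hg) hM0
    have h4 := mul_lt_mul_of_pos_left hgc ht
    linarith
  refine hle.trans_lt ?_
  have : (M + 2) * ε = η / 2 := by rw [hε]; field_simp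
  linarith

theorem norm_le_norm_comp_of_surjective {T : Op p} (hT : ∀ f, ‖T f‖ = ‖f‖)
    (hs : Function.Surjective T) (φ : StrongDual ℂ (LpI p)) : ‖φ‖ ≤ ‖φ ∘L T‖ := by
  refine φ.opNorm_le_bound (norm_nonneg _) fun f => ?_
  obtain ⟨g, rfl⟩ := hs f
  rw [hT]
  exact (φ ∘L T).le_opNorm g

/-- The range is closed, so a missed vector is separated from it by a nonzero functional vanishing
on the range, which the hypothesis on `φ ∘ T` forbids. -/
theorem surjective_of_isometry_of_comp {T : Op p} (hT : ∀ f, ‖T f‖ = ‖f‖)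
    (hφ : ∀ φ : StrongDual ℂ (LpI p), ‖φ‖ ≤ ‖φ ∘L T‖) : Function.Surjective T := by
  have hi : Isometry T := AddMonoidHomClass.isometry_of_norm T hT
  have hc : IsClosed (T.range : Set (LpI p)) := by
    rw [LinearMap.coe_range]
    exact hi.isClosedEmbedding.isClosed_range
  intro g
  by_contra hg
  have hg' : g ∉ T.range := fun ⟨f, hf⟩ => hg ⟨f, hf⟩
  obtain ⟨φ, hφg, hφT⟩ : ∃ φ : StrongDual ℂ (LpI p), φ g ≠ 0 ∧ ∀ x ∈ T.range, φ x = 0 := by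
    obtain ⟨φ, u, h1, h2⟩ := RCLike.geometric_hahn_banach_point_closed (𝕜 := ℂ)
      ((T.range.restrictScalars ℝ).convex) hc hg'
    have hu : u < 0 := by simpa using h2 0 (T.range.zero_mem)
    refine ⟨φ, fun h => ?_, fun x hx => ?_⟩
    · rw [h] at h1
      simp only [map_zero] at h1
      linarith
    · by_contra hx0
      -- On the range the real part of `φ` stays above `u`; rescaling `x` to make `φ` equal to `u`
      -- contradicts this.
      have := h2 (((u : ℂ) / φ x) • x) (T.range.smul_mem _ hx)
      rw [map_smul, smul_eq_mul, div_mul_cancel₀ _ hx0] at this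
      simp at this
  have h0 : φ ∘L T = 0 := by
    ext f
    simpa using hφT (T f) ⟨f, rfl⟩
  have := hφ φ
  rw [h0, norm_zero] at this
  have : φ = 0 := norm_le_zero_iff.1 this
  simp [this] at hφg

theorem mem_contractions_of_isometry {T : Op p} (hT : T ∈ positiveIsometries p) :
    T ∈ positiveContractions p := ⟨hT.1, fun f => (hT.2 f).le⟩

end Adjoint

/-! ### Partitions of `[0,1]` into affine copies of itself -/

section Tiling

/-- The maps `θ k` embed the unit interval onto essentially disjoint pieces which cover it, the
`k`-th piece having length `w k`. -/
structure IsTiling {K : Type*} [Fintype K] (w : K → ℝ) (θ : K → unitInterval → unitInterval) :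
    Prop where
  pos : ∀ k, 0 < w k
  emb : ∀ k, MeasurableEmbedding (θ k)
  vol : (volume : Measure unitInterval) = ∑ k, ENNReal.ofReal (w k) • volume.map (θ k)
  disj : ∀ k l, k ≠ l → ∀ᵐ t, θ l t ∉ range (θ k)
  lip : ∀ k s t, dist (θ k s) (θ k t) ≤ w k * dist s t

/-- The affine increasing map of `[0,1]` onto `[s,1]`. -/
def upperPiece (s t : unitInterval) : unitInterval :=
  ⟨s + (1 - s) * t, by
    have h1 := s.2.1
    have h2 := s.2.2
    have h3 := t.2.1
    have h4 := t.2.2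
    constructor <;> nlinarith⟩

theorem continuous_upperPiece (s : unitInterval) : Continuous (upperPiece s) := by
  unfold upperPiece; fun_prop

theorem volume_eq_add_map (s : unitInterval) (h0 : 0 < s) (h1 : s < 1) :
    (volume : Measure unitInterval) = ENNReal.ofReal s • volume.map (s * ·) +
      ENNReal.ofReal (1 - s) • volume.map (upperPiece s) := by
  have h0' : (0 : ℝ) < s := h0
  have h1' : (s : ℝ) < 1 := h1
  refine Measure.ext_of_Iic _ _ fun a => ?_
  have ha := a.2
  rw [Measure.add_apply, Measure.smul_apply, Measure.smul_apply,
    Measure.map_apply (by fun_prop) measurableSet_Iic,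
    Measure.map_apply (continuous_upperPiece s).measurable measurableSet_Iic,
    unitInterval.volume_Iic, smul_eq_mul, smul_eq_mul]
  rcases le_or_gt a s with h | h
  · have h' : (a : ℝ) ≤ s := h
    have e1 : (s * ·) ⁻¹' Iic a =
        Iic (⟨a / s, div_nonneg ha.1 h0'.le, (div_le_one h0').2 h'⟩ : unitInterval) := by
      ext t
      simp only [mem_preimage, mem_Iic, ← Subtype.coe_le_coe, le_div_iff₀ h0']
      rw [mul_comm]; rfl
    have e2 : volume (upperPiece s ⁻¹' Iic a) = 0 := by
      refine measure_mono_null (t := {0}) (fun t ht => ?_) (measure_singleton _)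
      have ht' : (s : ℝ) + (1 - s) * t ≤ a := ht
      have := t.2.1
      have h5 : (t : ℝ) = 0 := by
        refine le_antisymm ?_ this
        by_contra! h6
        nlinarith [mul_pos (sub_pos.2 h1') h6]
      exact mem_singleton_iff.2 (Subtype.ext h5)
    rw [e1, e2, unitInterval.volume_Iic, mul_zero, add_zero, ← ENNReal.ofReal_mul h0'.le]
    congr 1
    field_simp
  · have h' : (s : ℝ) < a := h
    have e1 : (s * ·) ⁻¹' Iic a = univ := by
      refine eq_univ_of_forall fun t => ?_
      have : (s : ℝ) * t ≤ a := by nlinarith [t.2.2]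
      exact this
    have e2 : upperPiece s ⁻¹' Iic a = Iic (⟨(a - s) / (1 - s), div_nonneg (by linarith)
        (by linarith), (div_le_one (by linarith)).2 (by linarith [ha.2])⟩ : unitInterval) := by
      ext t
      simp only [mem_preimage, mem_Iic, ← Subtype.coe_le_coe, le_div_iff₀ (sub_pos.2 h1')]
      simp only [upperPiece]
      constructor <;> intro <;> linarith
    rw [e1, e2, unitInterval.volume_Iic, measure_univ, mul_one, ← ENNReal.ofReal_mul (by linarith),
      ← ENNReal.ofReal_add h0'.le (by simp only; apply mul_nonneg; linarith; apply div_nonneg <;> linarith)]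
    congr 1
    have : (1 : ℝ) - s ≠ 0 := by linarith
    field_simp
    ring

theorem measurableEmbedding_mul {s : unitInterval} (h0 : 0 < s) :
    MeasurableEmbedding (s * · : unitInterval → unitInterval) := by
  refine Continuous.measurableEmbedding (by fun_prop) fun a b h => ?_
  have h' : (s : ℝ) * a = s * b := congrArg Subtype.val h
  exact Subtype.ext (mul_left_cancel₀ (show (0 : ℝ) < s from h0).ne' h')

theorem measurableEmbedding_upperPiece {s : unitInterval} (h1 : s < 1) :
    MeasurableEmbedding (upperPiece s) := by
  refine (continuous_upperPiece s).measurableEmbedding fun a b h => ?_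
  have h' : (s : ℝ) + (1 - s) * a = s + (1 - s) * b := congrArg Subtype.val h
  have h1' : (s : ℝ) < 1 := h1
  exact Subtype.ext (mul_left_cancel₀ (sub_pos.2 h1').ne' (add_left_cancel h'))

theorem ae_ne_of_injective {θ : unitInterval → unitInterval} (hθ : Function.Injective θ)
    (c : unitInterval) : ∀ᵐ t, θ t ≠ c := by
  have : {t | ¬ θ t ≠ c}.Subsingleton := fun a ha b hb => by
    simp only [mem_ofPred_eq, not_not] at ha hb
    exact hθ (ha.trans hb.symm)
  exact this.measure_zero _

/-- Squeeze the given tiling into `[s,1]` and put `[0,s]` in front. The two parts meet only at `s`,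
which is why disjointness is required only almost everywhere. -/
theorem IsTiling.cons {n : ℕ} {w : Fin n → ℝ} {θ : Fin n → unitInterval → unitInterval}
    (h : IsTiling w θ) {s : unitInterval} (h0 : 0 < s) (h1 : s < 1) :
    IsTiling (Fin.cons (s : ℝ) (fun k => (1 - s) * w k) : Fin (n + 1) → ℝ)
      (Fin.cons (s * ·) fun k => upperPiece s ∘ θ k) := by
  have h0' : (0 : ℝ) < s := h0
  have h1' : (s : ℝ) < 1 := h1
  have hs1 : 0 < 1 - (s : ℝ) := by linarith
  have up := measurableEmbedding_upperPiece h1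
  refine ⟨?_, ?_, ?_, ?_, ?_⟩
  · refine Fin.cases h0' fun k => ?_
    simp only [Fin.cons_succ]
    exact mul_pos hs1 (h.pos k)
  · exact Fin.cases (measurableEmbedding_mul h0) fun k => up.comp (h.emb k)
  · rw [Fin.sum_univ_succ]
    simp only [Fin.cons_zero, Fin.cons_succ]
    conv_lhs => rw [volume_eq_add_map s h0 h1]
    congr 1
    have : (volume : Measure unitInterval).map (upperPiece s) =
        ∑ k, ENNReal.ofReal (w k) • volume.map (upperPiece s ∘ θ k) := by
      conv_lhs => rw [h.vol]
      ext A hA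
      rw [Measure.map_apply up.measurable hA]
      simp only [Measure.coe_finsetSum, Finset.sum_apply, Measure.smul_apply]
      refine Finset.sum_congr rfl fun k _ => ?_
      rw [Measure.map_apply (h.emb k).measurable (up.measurable hA),
        Measure.map_apply (up.comp (h.emb k)).measurable hA]
      rfl
    rw [this, Finset.smul_sum]
    refine Finset.sum_congr rfl fun k _ => ?_
    rw [smul_smul, ENNReal.ofReal_mul hs1.le]
  · refine Fin.cases (Fin.cases (fun h => absurd rfl h) fun l _ => ?_) fun k =>
      Fin.cases (fun _ => ?_) fun l hkl => ?_
    · simp only [Fin.cons_zero, Fin.cons_succ]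
      filter_upwards [ae_ne_of_injective (h.emb l).injective 0] with t ht
      rintro ⟨x, hx⟩
      have hx' : (s : ℝ) * x = s + (1 - s) * θ l t := congrArg Subtype.val hx
      refine ht (Subtype.ext ?_)
      have := x.2.2
      have := (θ l t).2.1
      refine le_antisymm ?_ this
      by_contra! h6
      nlinarith [mul_pos hs1 h6]
    · simp only [Fin.cons_zero, Fin.cons_succ]
      filter_upwards [ae_ne_of_injective Function.injective_id 1] with t ht
      rintro ⟨x, hx⟩
      have hx' : (s : ℝ) + (1 - s) * θ k x = s * t := congrArg Subtype.val hx
      refine ht (Subtype.ext ?_)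
      have h5 := (θ k x).2.1
      refine le_antisymm t.2.2 ?_
      by_contra! h6
      have h7 : (t : ℝ) < 1 := h6
      nlinarith [mul_pos h0' (sub_pos.2 h7), mul_nonneg hs1.le h5]
    · simp only [Fin.cons_succ]
      filter_upwards [h.disj k l fun e => hkl (congrArg _ e)] with t ht
      rintro ⟨x, hx⟩
      exact ht ⟨x, up.injective hx⟩
  · refine Fin.cases (fun x y => ?_) fun k x y => ?_
    · simp only [Fin.cons_zero, Subtype.dist_eq, Real.dist_eq]
      change |(s : ℝ) * x - s * y| ≤ _
      rw [← mul_sub, abs_mul, abs_of_pos h0']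
    · simp only [Fin.cons_succ]
      have := h.lip k x y
      calc dist (upperPiece s (θ k x)) (upperPiece s (θ k y))
          = (1 - s) * dist (θ k x) (θ k y) := by
            simp only [Subtype.dist_eq, Real.dist_eq, upperPiece]
            rw [add_sub_add_left_eq_sub, ← mul_sub, abs_mul, abs_of_pos hs1]
        _ ≤ _ := by rw [mul_assoc]; gcongr

theorem exists_isTiling_fin (n : ℕ) : ∀ w : Fin (n + 1) → ℝ, (∀ k, 0 < w k) → ∑ k, w k = 1 →
    ∃ θ, IsTiling w θ := by
  induction n with
  | zero =>
    intro w hw hs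
    have hsub : Subsingleton (Fin (0 + 1)) := inferInstanceAs (Subsingleton (Fin 1))
    have hw1 : ∀ k, w k = 1 := fun k => by
      rw [Subsingleton.elim k 0]
      simpa using hs
    refine ⟨fun _ => id, hw, fun _ => MeasurableEmbedding.id, ?_, fun k l h =>
      absurd (Subsingleton.elim k l) h, fun k s t => ?_⟩
    · simp [hw1]
    · simp [hw1]
  | succ n ih =>
    intro w hw hs
    rw [Fin.sum_univ_succ] at hs
    have hpos : 0 < ∑ k : Fin (n + 1), w k.succ :=
      Finset.sum_pos (fun k _ => hw _) Finset.univ_nonempty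
    have hne : 1 - w 0 ≠ 0 := by linarith
    obtain ⟨θ, hθ⟩ := ih (fun k => w k.succ / (1 - w 0)) (fun k => div_pos (hw _) (by linarith))
      (by rw [← Finset.sum_div, div_eq_one_iff_eq hne]; linarith)
    have h := hθ.cons (s := ⟨w 0, (hw 0).le, by linarith⟩) (hw 0)
      (show w 0 < 1 by linarith)
    have hww : (Fin.cons (w 0) fun k : Fin (n + 1) => (1 - w 0) * (w k.succ / (1 - w 0))) = w := by
      refine funext (Fin.cases rfl fun k => ?_)
      simp only [Fin.cons_succ]
      field_simp
    simp only [hww] at h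
    exact ⟨_, h⟩

theorem exists_isTiling {K : Type*} [Fintype K] [Nonempty K] (w : K → ℝ) (hw : ∀ k, 0 < w k)
    (hs : ∑ k, w k = 1) : ∃ θ, IsTiling w θ := by
  obtain ⟨n, hn⟩ := Nat.exists_eq_succ_of_ne_zero (Fintype.card_ne_zero (α := K))
  let e : K ≃ Fin (n + 1) := Fintype.equivFinOfCardEq hn
  obtain ⟨θ, hθ⟩ := exists_isTiling_fin n (w ∘ e.symm) (fun k => hw _)
    (by rw [← hs]; exact Equiv.sum_comp e.symm w)
  refine ⟨θ ∘ e, hw, fun k => hθ.emb _, ?_, fun k l h => hθ.disj _ _ fun h' => h (e.injective h'),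
    fun k s t => ?_⟩
  · refine hθ.vol.trans ?_
    rw [← Equiv.sum_comp e]
    simp
  · simpa using hθ.lip (e k) s t

end Tiling

/-! ### Null sets, integrals and extension by zero along a tiling -/

section TilingMeasure

variable {K : Type*} [Fintype K] {w : K → ℝ} {θ : K → unitInterval → unitInterval}

theorem IsTiling.ae_iff (h : IsTiling w θ) {P : unitInterval → Prop} :
    (∀ᵐ x, P x) ↔ ∀ k, ∀ᵐ t, P (θ k t) := by
  have hk : ∀ k, (∀ᵐ x ∂(ENNReal.ofReal (w k) • (volume : Measure unitInterval).map (θ k)), P x) ↔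
      ∀ᵐ t, P (θ k t) := fun k => by
    rw [Measure.ae_ennreal_smul_measure_iff (by simpa using h.pos k), (h.emb k).ae_map_iff]
  conv_lhs => rw [h.vol]
  rw [ae_finsetSum_measure_iff]
  simp only [Finset.mem_univ, true_imp_iff, hk]

theorem IsTiling.integrable_iff (h : IsTiling w θ) {E : Type*} [NormedAddCommGroup E]
    {f : unitInterval → E} : Integrable f ↔ ∀ k, Integrable fun t => f (θ k t) := by
  have hk : ∀ k, Integrable f (ENNReal.ofReal (w k) • (volume : Measure unitInterval).map (θ k)) ↔
      Integrable fun t => f (θ k t) := fun k => by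
    rw [integrable_smul_measure (by simpa using h.pos k) (by simp), (h.emb k).integrable_map_iff]
    rfl
  conv_lhs => rw [h.vol]
  rw [integrable_finsetSum_measure]
  simp only [Finset.mem_univ, true_imp_iff, hk]

theorem IsTiling.integral_eq (h : IsTiling w θ) {E : Type*} [NormedAddCommGroup E]
    [NormedSpace ℝ E] {f : unitInterval → E} (hf : Integrable f) :
    ∫ x, f x = ∑ k, w k • ∫ t, f (θ k t) := by
  have hf' := hf
  rw [h.vol, integrable_finsetSum_measure] at hf'
  conv_lhs => rw [h.vol]
  rw [integral_finsetSum_measure hf']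
  refine Finset.sum_congr rfl fun k _ => ?_
  rw [integral_smul_measure, (h.emb k).integral_map, ENNReal.toReal_ofReal (h.pos k).le]

theorem IsTiling.aestronglyMeasurable_comp (h : IsTiling w θ) {f : unitInterval → ℂ}
    (hf : AEStronglyMeasurable f) (k : K) : AEStronglyMeasurable fun t => f (θ k t) := by
  refine ⟨fun t => hf.mk f (θ k t),
    hf.stronglyMeasurable_mk.comp_measurable (h.emb k).measurable, ?_⟩
  exact h.ae_iff.1 hf.ae_eq_mk k

theorem IsTiling.extend_same (h : IsTiling w θ) (k : K) (g : unitInterval → ℂ) (t : unitInterval) :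
    Function.extend (θ k) g 0 (θ k t) = g t :=
  (h.emb k).injective.extend_apply _ _ _

theorem IsTiling.extend_ne (h : IsTiling w θ) {k l : K} (hkl : k ≠ l) :
    ∀ᵐ t, ∀ g : unitInterval → ℂ, Function.extend (θ k) g 0 (θ l t) = 0 := by
  filter_upwards [h.disj k l hkl] with t ht g
  exact Function.extend_apply' _ _ _ ht

theorem IsTiling.extend_ae (h : IsTiling w θ) (k : K) {f g : unitInterval → ℂ} (hfg : f =ᵐ[volume] g) :
    Function.extend (θ k) f 0 =ᵐ[volume] Function.extend (θ k) g 0 := by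
  refine h.ae_iff.2 fun l => ?_
  by_cases hkl : k = l
  · subst hkl
    filter_upwards [hfg] with t ht
    rw [h.extend_same, h.extend_same, ht]
  · filter_upwards [h.extend_ne hkl] with t ht
    rw [ht, ht]

theorem IsTiling.aestronglyMeasurable_extend (h : IsTiling w θ) {g : unitInterval → ℂ}
    (hg : AEStronglyMeasurable g) (k : K) : AEStronglyMeasurable (Function.extend (θ k) g 0) :=
  ⟨Function.extend (θ k) (hg.mk g) 0,
    ((h.emb k).measurable_extend hg.stronglyMeasurable_mk.measurable
      measurable_zero).stronglyMeasurable, h.extend_ae k hg.ae_eq_mk⟩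

end TilingMeasure

/-! ### Restriction to and extension from a piece -/

section Operators

variable {p : ℝ≥0∞} [Fact (1 ≤ p)]

/-- An `L^p`-contractive linear prescription on functions induces an operator. -/
theorem exists_op (hp' : p ≠ ∞) (Φ : (unitInterval → ℂ) → unitInterval → ℂ)
    (hae : ∀ f g : unitInterval → ℂ, f =ᵐ[volume] g → Φ f =ᵐ[volume] Φ g)
    (hadd : ∀ f g, Φ (f + g) = Φ f + Φ g) (hsmul : ∀ (c : ℂ) f, Φ (c • f) = c • Φ f)
    (hmeas : ∀ f : LpI p, AEStronglyMeasurable (Φ f))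
    (hint : ∀ f : LpI p, Integrable fun x => ‖Φ f x‖ ^ p.toReal)
    (hle : ∀ f : LpI p, ∫ x, ‖Φ f x‖ ^ p.toReal ≤ ∫ x, ‖f x‖ ^ p.toReal) :
    ∃ T : Op p, ∀ f, T f =ᵐ[volume] Φ f := by
  have hmem : ∀ f : LpI p, MemLp (Φ f) p := fun f =>
    (integrable_norm_rpow_iff (hmeas f) (zero_lt_one.trans_le Fact.out).ne' hp').1 (hint f)
  let L : LpI p →ₗ[ℂ] LpI p :=
    { toFun := fun f => (hmem f).toLp
      map_add' := fun f g => by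
        rw [← MemLp.toLp_add]
        exact MemLp.toLp_congr _ _ ((hae _ _ (Lp.coeFn_add f g)).trans (by rw [hadd]))
      map_smul' := fun c f => by
        rw [RingHom.id_apply, ← MemLp.toLp_const_smul]
        exact MemLp.toLp_congr _ _ ((hae _ _ (Lp.coeFn_smul c f)).trans (by rw [hsmul])) }
  have hL : ∀ f, L f =ᵐ[volume] Φ f := fun f => MemLp.coeFn_toLp (hmem f)
  refine ⟨L.mkContinuous 1 fun f => ?_, hL⟩
  rw [one_mul, ← Real.rpow_le_rpow_iff (norm_nonneg _) (norm_nonneg _) (toReal_pos' hp'),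
    norm_rpow_eq_integral hp', norm_rpow_eq_integral hp']
  refine le_trans (le_of_eq (integral_congr_ae ?_)) (hle f)
  filter_upwards [hL f] with x hx
  rw [hx]

variable {K : Type*} [Fintype K] {w : K → ℝ} {θ : K → unitInterval → unitInterval}

theorem IsTiling.norm_rpow_eq (h : IsTiling w θ) (hp' : p ≠ ∞) (f : LpI p) :
    ‖f‖ ^ p.toReal = ∑ k, w k * ∫ t, ‖f (θ k t)‖ ^ p.toReal := by
  rw [norm_rpow_eq_integral hp', h.integral_eq (integrable_norm_rpow hp' f)]
  rfl

theorem norm_rpow_inv_mul_rpow {q w : ℝ} (hq : 0 < q) (hw : 0 < w) (z : ℂ) :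
    ‖((w ^ q⁻¹ : ℝ) : ℂ) * z‖ ^ q = w * ‖z‖ ^ q := by
  have : 0 ≤ w ^ q⁻¹ := by positivity
  rw [norm_mul, Complex.norm_real, Real.norm_of_nonneg this,
    Real.mul_rpow this (norm_nonneg _), ← Real.rpow_mul hw.le, inv_mul_cancel₀ hq.ne',
    Real.rpow_one]

/-- The factor `w k ^ (1/q)`, `q = p.toReal`, compensates for the change of variables, so that the
restrictions together preserve the `L^p` norm. -/
theorem IsTiling.exists_restriction (h : IsTiling w θ) (hp' : p ≠ ∞) (k : K) :
    ∃ ρ : Op p, ∀ f, ∀ᵐ t, ρ f t = ((w k ^ p.toReal⁻¹ : ℝ) : ℂ) * f (θ k t) := by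
  have hq := toReal_pos' hp'
  have e : ∀ f : LpI p, ∀ t, ‖((w k ^ p.toReal⁻¹ : ℝ) : ℂ) * f (θ k t)‖ ^ p.toReal =
      w k * ‖f (θ k t)‖ ^ p.toReal := fun f t => norm_rpow_inv_mul_rpow hq (h.pos k) _
  refine exists_op hp' (fun f t => ((w k ^ p.toReal⁻¹ : ℝ) : ℂ) * f (θ k t)) (fun f g hfg => ?_)
    (fun f g => ?_) (fun c f => ?_) (fun f => ?_) (fun f => ?_) (fun f => ?_)
  · filter_upwards [h.ae_iff.1 hfg k] with t ht
    rw [ht]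
  · ext t; simp [mul_add]
  · ext t; simp [mul_left_comm]
  · exact (h.aestronglyMeasurable_comp (Lp.aestronglyMeasurable f) k).const_mul _
  · simp only [e]
    exact (h.integrable_iff.1 (integrable_norm_rpow hp' f) k).const_mul _
  · simp only [e]
    rw [integral_const_mul, ← norm_rpow_eq_integral hp', h.norm_rpow_eq hp']
    exact Finset.single_le_sum (f := fun k => w k * ∫ t, ‖f (θ k t)‖ ^ p.toReal)
      (fun l _ => mul_nonneg (h.pos l).le (integral_nonneg fun t => by positivity))
      (Finset.mem_univ k)

theorem IsTiling.exists_extension (h : IsTiling w θ) (hp' : p ≠ ∞) (k : K) :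
    ∃ ι : Op p, ∀ g, ∀ᵐ x, ι g x =
      (((w k)⁻¹ ^ p.toReal⁻¹ : ℝ) : ℂ) * Function.extend (θ k) g 0 x := by
  have hq := toReal_pos' hp'
  have e : ∀ g : LpI p, ∀ x,
      ‖(((w k)⁻¹ ^ p.toReal⁻¹ : ℝ) : ℂ) * Function.extend (θ k) g 0 x‖ ^ p.toReal =
      (w k)⁻¹ * ‖Function.extend (θ k) g 0 x‖ ^ p.toReal :=
    fun f t => norm_rpow_inv_mul_rpow hq (inv_pos.2 (h.pos k)) _
  have hne : ∀ (g : LpI p) (l : K), k ≠ l →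
      (fun t => ‖Function.extend (θ k) g 0 (θ l t)‖ ^ p.toReal) =ᵐ[volume] 0 := fun g l hkl => by
    filter_upwards [h.extend_ne hkl] with t ht
    rw [ht, norm_zero, Real.zero_rpow hq.ne']; rfl
  have hi : ∀ g : LpI p, Integrable fun x => ‖Function.extend (θ k) g 0 x‖ ^ p.toReal := fun g => by
    refine h.integrable_iff.2 fun l => ?_
    by_cases hkl : k = l
    · subst hkl
      simp only [h.extend_same]
      exact integrable_norm_rpow hp' g
    · exact (integrable_zero _ _ _).congr (hne g l hkl).symm
  refine exists_op hp' (fun g x => (((w k)⁻¹ ^ p.toReal⁻¹ : ℝ) : ℂ) * Function.extend (θ k) g 0 x)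
    (fun f g hfg => ?_) (fun f g => ?_) (fun c f => ?_) (fun f => ?_) (fun f => ?_) (fun f => ?_)
  · filter_upwards [h.extend_ae k hfg] with t ht
    rw [ht]
  · ext x
    have := congrFun (Function.extend_add (θ k) f g 0 0) x
    rw [add_zero] at this
    simp only [this, Pi.add_apply, mul_add]
  · ext x
    have := congrFun (Function.extend_smul c (θ k) f 0) x
    rw [smul_zero] at this
    simp only [this, Pi.smul_apply, smul_eq_mul, mul_left_comm]
  · exact (h.aestronglyMeasurable_extend (Lp.aestronglyMeasurable f) k).const_mul _
  · simp only [e]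
    exact (hi f).const_mul _
  · simp only [e]
    rw [integral_const_mul, h.integral_eq (hi f), Finset.sum_eq_single k]
    · simp only [h.extend_same]
      rw [smul_eq_mul, inv_mul_cancel_left₀ (h.pos k).ne']
    · intro l _ hl
      rw [integral_congr_ae (hne f l hl.symm)]
      simp
    · simp

end Operators

/-! ### The mean functional and the projection onto constants -/

section Mean

/-- The constant function `1`. -/
noncomputable def one (p : ℝ≥0∞) : LpI p := Lp.const p volume 1

theorem coeFn_one (p : ℝ≥0∞) : ∀ᵐ x, one p x = 1 := Lp.coeFn_const p volume (1 : ℂ)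

variable (p : ℝ≥0∞) [Fact (1 ≤ p)]

theorem norm_one : ‖one p‖ = 1 := by
  rw [one, Lp.norm_const p volume (1 : ℂ) (zero_lt_one.trans_le Fact.out).ne']
  simp

variable {p} in
theorem integrable_coeFn (f : LpI p) : Integrable f :=
  (Lp.memLp f).integrable Fact.out

/-- The integral, as a functional on `L^p[0,1]`. -/
noncomputable def mean : LpI p →L[ℂ] ℂ :=
  LinearMap.mkContinuous
    { toFun := fun f => ∫ x, f x
      map_add' := fun f g => by
        rw [integral_congr_ae (Lp.coeFn_add f g)]
        exact integral_add (integrable_coeFn f) (integrable_coeFn g)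
      map_smul' := fun c f => by
        rw [integral_congr_ae (Lp.coeFn_smul c f)]
        exact integral_smul c f } 1 fun f => by
    rw [one_mul]
    refine (norm_integral_le_integral_norm _).trans ?_
    have h1 : ∫ x, ‖f x‖ = (eLpNorm f 1 volume).toReal := by
      rw [eLpNorm_one_eq_lintegral_enorm,
        integral_norm_eq_lintegral_enorm (Lp.aestronglyMeasurable f)]
    rw [h1, Lp.norm_def]
    exact ENNReal.toReal_mono (Lp.eLpNorm_ne_top f)
      (eLpNorm_le_eLpNorm_of_exponent_le Fact.out (Lp.aestronglyMeasurable f))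

theorem mean_apply (f : LpI p) : mean p f = ∫ x, f x := rfl

theorem norm_mean_le (f : LpI p) : ‖mean p f‖ ≤ ‖f‖ := by
  simpa using (mean p).le_of_opNorm_le (LinearMap.mkContinuous_norm_le _ zero_le_one _) f

theorem mean_one : mean p (one p) = 1 := by
  rw [mean_apply, integral_congr_ae (coeFn_one p)]
  simp

variable {p} in
theorem mean_nonneg {f : LpI p} (hf : ∀ᵐ x, 0 ≤ f x) : 0 ≤ mean p f := by
  have h : ∫ x, f x = ((∫ x, (f x).re : ℝ) : ℂ) := by
    rw [← integral_complex_ofReal]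
    refine integral_congr_ae ?_
    filter_upwards [hf] with x hx
    exact (Complex.eq_re_of_ofReal_le (r := 0) (by simpa using hx))
  rw [mean_apply, h, Complex.zero_le_real]
  refine integral_nonneg_of_ae ?_
  filter_upwards [hf] with x hx
  exact (Complex.nonneg_iff.1 hx).1

/-- The projection onto the constants. -/
noncomputable def avg : Op p := (mean p).smulRight (one p)

theorem avg_apply (f : LpI p) : avg p f = mean p f • one p := rfl

theorem norm_avg_le (f : LpI p) : ‖avg p f‖ ≤ ‖f‖ := by
  rw [avg_apply, norm_smul, norm_one, mul_one]
  exact norm_mean_le p f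

omit [Fact (1 ≤ p)] in
theorem smul_one_nonneg {c : ℂ} (hc : 0 ≤ c) : ∀ᵐ x, 0 ≤ (c • one p) x := by
  filter_upwards [Lp.coeFn_smul c (one p), coeFn_one p] with x h1 h2
  rw [h1, Pi.smul_apply, h2]
  simpa using hc

theorem isPositive_avg : IsPositive (avg p) := fun _ hf => smul_one_nonneg p (mean_nonneg hf)

end Mean

/-! ### `ℓ^p`-decompositions of `L^p` and their averaging operators -/

section System

variable {p : ℝ≥0∞} [Fact (1 ≤ p)] {K : Type*} [Fintype K]

/-- A decomposition of `L^p[0,1]` into an `ℓ^p`-sum of copies of itself, `ι k` being the embedding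
of the `k`-th copy, carried by a piece of length `w k`, and `ρ k` the restriction to it. -/
structure IsSystem (w : K → ℝ) (ι ρ : K → Op p) : Prop where
  pos : ∀ k, 0 < w k
  pos_ι : ∀ k, IsPositive (ι k)
  pos_ρ : ∀ k, IsPositive (ρ k)
  ρ_ι_self : ∀ k f, ρ k (ι k f) = f
  ρ_ι_ne : ∀ k l, k ≠ l → ∀ f, ρ k (ι l f) = 0
  sum_norm : ∀ f, ∑ k, ‖ρ k f‖ ^ p.toReal = ‖f‖ ^ p.toReal
  ρ_one : ∀ k, ρ k (one p) = ((w k ^ p.toReal⁻¹ : ℝ) : ℂ) • one p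
  mean_ι : ∀ k f, mean p (ι k f) = ((w k ^ (1 - p.toReal⁻¹) : ℝ) : ℂ) * mean p f

/-- The explicit formula for `ρ` is kept beside the abstract system because convergence of the
averages needs the geometry of the pieces. -/
theorem IsTiling.exists_isSystem (hp' : p ≠ ∞) {w : K → ℝ} {θ : K → unitInterval → unitInterval}
    (h : IsTiling w θ) : ∃ ι ρ : K → Op p, IsSystem w ι ρ ∧
      ∀ k f, ∀ᵐ t, ρ k f t = ((w k ^ p.toReal⁻¹ : ℝ) : ℂ) * f (θ k t) := by
  have hq := toReal_pos' hp'
  choose ρ hρ using h.exists_restriction hp'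
  choose ι hι using h.exists_extension hp'
  have hc : ∀ k, 0 ≤ w k ^ p.toReal⁻¹ := fun k => Real.rpow_nonneg (h.pos k).le _
  have hcc : ∀ k, ((w k ^ p.toReal⁻¹ : ℝ) : ℂ) * (((w k)⁻¹ ^ p.toReal⁻¹ : ℝ) : ℂ) = 1 := fun k => by
    rw [← Complex.ofReal_mul, ← Real.mul_rpow (h.pos k).le (inv_pos.2 (h.pos k)).le,
      mul_inv_cancel₀ (h.pos k).ne', Real.one_rpow, Complex.ofReal_one]
  have hι_same : ∀ k g, ∀ᵐ t, ι k g (θ k t) = (((w k)⁻¹ ^ p.toReal⁻¹ : ℝ) : ℂ) * g t := fun k g => by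
    filter_upwards [h.ae_iff.1 (hι k g) k] with t ht
    rw [ht, h.extend_same]
  have hι_ne : ∀ k l, k ≠ l → ∀ g, ∀ᵐ t, ι k g (θ l t) = 0 := fun k l hkl g => by
    filter_upwards [h.ae_iff.1 (hι k g) l, h.extend_ne hkl] with t ht ht'
    rw [ht, ht', mul_zero]
  refine ⟨ι, ρ, ⟨h.pos, fun k f hf => ?_, fun k f hf => ?_, fun k f => ?_, fun k l hkl f => ?_,
    fun f => ?_, fun k => ?_, fun k f => ?_⟩, hρ⟩
  · refine h.ae_iff.2 fun l => ?_
    by_cases hkl : k = l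
    · subst hkl
      filter_upwards [hι_same k f, hf] with t h1 h2
      rw [h1]
      refine mul_nonneg ?_ h2
      rw [Complex.zero_le_real]
      exact Real.rpow_nonneg (inv_pos.2 (h.pos k)).le _
    · filter_upwards [hι_ne k l hkl f] with t h1
      rw [h1]
  · filter_upwards [hρ k f, h.ae_iff.1 hf k] with t h1 h2
    rw [h1]
    exact mul_nonneg (Complex.zero_le_real.2 (hc k)) h2
  · refine Lp.ext ?_
    filter_upwards [hρ k (ι k f), hι_same k f] with t h1 h2
    rw [h1, h2, ← mul_assoc, hcc, one_mul]
  · refine Lp.ext ?_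
    filter_upwards [hρ k (ι l f), hι_ne l k hkl.symm f, Lp.coeFn_zero ℂ p volume] with t h1 h2 h3
    rw [h1, h2, mul_zero, h3, Pi.zero_apply]
  · rw [h.norm_rpow_eq hp' f]
    refine Finset.sum_congr rfl fun k _ => ?_
    rw [norm_rpow_eq_integral hp', ← integral_const_mul]
    refine integral_congr_ae ?_
    filter_upwards [hρ k f] with t ht
    rw [ht, norm_rpow_inv_mul_rpow hq (h.pos k)]
  · refine Lp.ext ?_
    filter_upwards [hρ k (one p), h.ae_iff.1 (coeFn_one p) k, coeFn_one p,
      Lp.coeFn_smul ((w k ^ p.toReal⁻¹ : ℝ) : ℂ) (one p)] with t h1 h2 h3 h4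
    rw [h1, h2, h4, Pi.smul_apply, h3, smul_eq_mul]
  · rw [mean_apply, mean_apply, h.integral_eq (integrable_coeFn _), Finset.sum_eq_single k]
    · rw [integral_congr_ae (hι_same k f), integral_const_mul, Complex.real_smul, ← mul_assoc,
        ← Complex.ofReal_mul, Real.inv_rpow (h.pos k).le, Real.rpow_sub (h.pos k), Real.rpow_one]
      rfl
    · intro l _ hl
      rw [integral_congr_ae (hι_ne k l hl.symm f)]
      simp
    · simp

variable {w : K → ℝ} {ι ρ : K → Op p}

theorem IsSystem.ext (h : IsSystem w ι ρ) (hp' : p ≠ ∞) {f g : LpI p} (hfg : ∀ k, ρ k f = ρ k g) :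
    f = g := by
  have hq := toReal_pos' hp'
  rw [← sub_eq_zero, ← norm_eq_zero, ← Real.rpow_eq_zero (norm_nonneg _) hq.ne', ← h.sum_norm]
  refine Finset.sum_eq_zero fun k _ => ?_
  rw [map_sub, hfg, sub_self, norm_zero, Real.zero_rpow hq.ne']

theorem IsSystem.ρ_sum (h : IsSystem w ι ρ) (g : K → LpI p) (k : K) :
    ρ k (∑ l, ι l (g l)) = g k := by
  rw [map_sum, Finset.sum_eq_single k, h.ρ_ι_self]
  · exact fun l _ hl => h.ρ_ι_ne k l hl.symm _
  · simp

theorem IsSystem.norm_sum (h : IsSystem w ι ρ) (g : K → LpI p) :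
    ‖∑ l, ι l (g l)‖ ^ p.toReal = ∑ k, ‖g k‖ ^ p.toReal := by
  rw [← h.sum_norm]
  simp only [h.ρ_sum]

theorem IsSystem.norm_ρ_le (h : IsSystem w ι ρ) (hp' : p ≠ ∞) (k : K) (f : LpI p) :
    ‖ρ k f‖ ≤ ‖f‖ := by
  rw [← Real.rpow_le_rpow_iff (norm_nonneg _) (norm_nonneg _) (toReal_pos' hp'), ← h.sum_norm f]
  exact Finset.single_le_sum (f := fun k => ‖ρ k f‖ ^ p.toReal) (fun l _ => by positivity)
    (Finset.mem_univ k)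

theorem IsSystem.norm_ι (h : IsSystem w ι ρ) (hp' : p ≠ ∞) (k : K) (f : LpI p) :
    ‖ι k f‖ = ‖f‖ := by
  have hq := toReal_pos' hp'
  rw [← Real.rpow_left_inj (norm_nonneg _) (norm_nonneg _) hq.ne', ← h.sum_norm,
    Finset.sum_eq_single k, h.ρ_ι_self]
  · intro l _ hl
    rw [h.ρ_ι_ne l k hl, norm_zero, Real.zero_rpow hq.ne']
  · simp

/-- Cutting every piece again, in its own proportions, multiplies the lengths. -/
theorem IsSystem.comp (h : IsSystem w ι ρ) {J : Type*} [Fintype J] {w' : K → J → ℝ}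
    {ι' ρ' : K → J → Op p} (h' : ∀ k, IsSystem (w' k) (ι' k) (ρ' k)) :
    IsSystem (fun kj : K × J => w kj.1 * w' kj.1 kj.2) (fun kj => ι kj.1 ∘L ι' kj.1 kj.2)
      (fun kj => ρ' kj.1 kj.2 ∘L ρ kj.1) where
  pos kj := mul_pos (h.pos _) ((h' _).pos _)
  pos_ι kj f hf := h.pos_ι _ _ ((h' _).pos_ι _ _ hf)
  pos_ρ kj f hf := (h' _).pos_ρ _ _ (h.pos_ρ _ _ hf)
  ρ_ι_self kj f := by simp [h.ρ_ι_self, (h' _).ρ_ι_self]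
  ρ_ι_ne := by
    rintro ⟨k, i⟩ ⟨l, j⟩ hne f
    by_cases hkl : k = l
    · subst hkl
      simp [h.ρ_ι_self, (h' k).ρ_ι_ne i j (fun e => hne (by rw [e]))]
    · simp [h.ρ_ι_ne k l hkl]
  sum_norm f := by
    rw [Fintype.sum_prod_type]
    simp only [ContinuousLinearMap.comp_apply, (h' _).sum_norm, h.sum_norm]
  ρ_one kj := by
    rw [ContinuousLinearMap.comp_apply, h.ρ_one, map_smul, (h' _).ρ_one, smul_smul,
      ← Complex.ofReal_mul, Real.mul_rpow (h.pos _).le ((h' _).pos _).le]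
  mean_ι kj f := by
    rw [ContinuousLinearMap.comp_apply, h.mean_ι, (h' _).mean_ι, ← mul_assoc,
      ← Complex.ofReal_mul, Real.mul_rpow (h.pos _).le ((h' _).pos _).le]

theorem IsSystem.reindex (h : IsSystem w ι ρ) {J : Type*} [Fintype J] (e : J ≃ K) :
    IsSystem (w ∘ e) (ι ∘ e) (ρ ∘ e) where
  pos k := h.pos _
  pos_ι k := h.pos_ι _
  pos_ρ k := h.pos_ρ _
  ρ_ι_self k := h.ρ_ι_self _
  ρ_ι_ne k l hkl := h.ρ_ι_ne _ _ (e.injective.ne hkl)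
  sum_norm f := by
    rw [← h.sum_norm f, ← Equiv.sum_comp e]
    rfl
  ρ_one k := h.ρ_one _
  mean_ι k := h.mean_ι _

theorem exists_isSystem (hp' : p ≠ ∞) [Nonempty K] (w : K → ℝ) (hw : ∀ k, 0 < w k)
    (hs : ∑ k, w k = 1) : ∃ ι ρ : K → Op p, IsSystem w ι ρ := by
  obtain ⟨θ, hθ⟩ := exists_isTiling w hw hs
  obtain ⟨ι, ρ, h, -⟩ := hθ.exists_isSystem hp'
  exact ⟨ι, ρ, h⟩

theorem isPositive_sum {J : Type*} (s : Finset J) (T : J → Op p) (hT : ∀ j, IsPositive (T j)) :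
    IsPositive (∑ j ∈ s, T j) := by
  classical
  induction s using Finset.induction_on with
  | empty =>
    intro f _
    rw [Finset.sum_empty, zero_apply]
    filter_upwards [Lp.coeFn_zero ℂ p volume] with x hx
    rw [hx]; rfl
  | insert a s ha ih =>
    intro f hf
    rw [Finset.sum_insert ha, add_apply]
    filter_upwards [Lp.coeFn_add (T a f) ((∑ j ∈ s, T j) f), hT a f hf, ih f hf] with x h1 h2 h3
    rw [h1]
    exact add_nonneg h2 h3

/-- Matching the pieces of two systems through invertible isometries gives an invertible
isometry. -/
theorem IsSystem.sum_mem (h : IsSystem w ι ρ) (hp' : p ≠ ∞) {w' : K → ℝ} {ι' ρ' : K → Op p}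
    (h' : IsSystem w' ι' ρ') {W : K → Op p} (hW : ∀ k, W k ∈ positiveInvertibleIsometries p) :
    ∑ k, ι k ∘L W k ∘L ρ' k ∈ positiveInvertibleIsometries p := by
  have hq := toReal_pos' hp'
  have ha : ∀ f, (∑ k, ι k ∘L W k ∘L ρ' k) f = ∑ k, ι k (W k (ρ' k f)) := fun f => by
    simp [sum_apply]
  refine ⟨isPositive_sum _ _ fun k f hf =>
    h.pos_ι k _ ((hW k).1 _ (h'.pos_ρ k _ hf)), fun f => ?_, fun g => ?_⟩
  · rw [← Real.rpow_left_inj (norm_nonneg _) (norm_nonneg _) hq.ne', ha, h.norm_sum, ← h'.sum_norm]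
    simp only [(hW _).2.1]
  · choose v hv using fun k => (hW k).2.2 (ρ k g)
    refine ⟨∑ k, ι' k (v k), h.ext hp' fun k => ?_⟩
    rw [ha, h.ρ_sum, h'.ρ_sum, hv]

/-- The averaging operator of a system. -/
noncomputable def average (ι ρ : K → Op p) : Op p := ∑ k, ι k ∘L avg p ∘L ρ k

theorem average_apply (ι ρ : K → Op p) (f : LpI p) :
    average ι ρ f = ∑ k, ι k (avg p (ρ k f)) := by
  simp [average, sum_apply]

theorem IsSystem.average_mem (h : IsSystem w ι ρ) (hp' : p ≠ ∞) :
    average ι ρ ∈ positiveContractions p := by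
  refine ⟨isPositive_sum _ _ fun k f hf =>
    h.pos_ι k _ (isPositive_avg p _ (h.pos_ρ k _ hf)), fun f => ?_⟩
  rw [← Real.rpow_le_rpow_iff (norm_nonneg _) (norm_nonneg _) (toReal_pos' hp'), average_apply,
    h.norm_sum, ← h.sum_norm f]
  exact Finset.sum_le_sum fun k _ =>
    Real.rpow_le_rpow (norm_nonneg _) (norm_avg_le p _) (toReal_pos' hp').le

end System

/-! ### A nonlinear Perron-Frobenius argument for positive matrices -/

section Matrix

variable {K : Type*} [Fintype K] {q : ℝ}

/-- First-order optimality of `x` in the direction of the `j`-th coordinate. As `x j` may be zero,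
only increments `t > 0` are admissible; hence an inequality. -/
theorem sum_mul_rpow_le_of_isMax (hq : 1 < q) {a : K → K → ℝ} {μ : ℝ}
    (hμ : ∀ z : K → ℝ, (∀ j, 0 ≤ z j) → ∑ i, (∑ j, a i j * z j) ^ q ≤ μ * ∑ j, z j ^ q)
    {x : K → ℝ} (hx : ∀ j, 0 ≤ x j) (hxμ : ∑ i, (∑ j, a i j * x j) ^ q = μ * ∑ j, x j ^ q) (j : K) :
    ∑ i, a i j * (∑ j, a i j * x j) ^ (q - 1) ≤ μ * x j ^ (q - 1) := by
  classical
  set y : K → ℝ := fun i => ∑ j, a i j * x j with hy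
  have hd : ∀ u v : ℝ, HasDerivAt (fun t : ℝ => (u + t * v) ^ q) (v * q * u ^ (q - 1)) 0 :=
    fun u v => by
      have h1 : HasDerivAt (fun t : ℝ => u + t * v) v 0 := by
        simpa using ((hasDerivAt_id (0 : ℝ)).mul_const v).const_add u
      simpa using h1.rpow_const (p := q) (Or.inr hq.le)
  set δ : K → ℝ := fun k => if k = j then 1 else 0 with hδ
  have hg : HasDerivAt (fun t : ℝ => μ * ∑ k, (x k + t * δ k) ^ q - ∑ i, (y i + t * a i j) ^ q)
      (μ * ∑ k, δ k * q * x k ^ (q - 1) - ∑ i, a i j * q * y i ^ (q - 1)) 0 :=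
    ((HasDerivAt.fun_sum fun k _ => hd (x k) (δ k)).const_mul μ).sub
      (HasDerivAt.fun_sum fun i _ => hd (y i) (a i j))
  have hlim := hg.tendsto_slope_zero_right
  have hnn : 0 ≤ μ * ∑ k, δ k * q * x k ^ (q - 1) - ∑ i, a i j * q * y i ^ (q - 1) := by
    refine ge_of_tendsto hlim ?_
    filter_upwards [self_mem_nhdsWithin] with t ht
    have ht0 : (0 : ℝ) < t := ht
    have h1 := hμ (fun k => x k + t * δ k) fun k => add_nonneg (hx k)
      (mul_nonneg ht0.le (by simp only [hδ]; split_ifs <;> norm_num))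
    have h2 : ∀ i, ∑ k, a i k * (x k + t * δ k) = y i + t * a i j := fun i => by
      simp only [hδ, mul_add, Finset.sum_add_distrib, hy, mul_ite, mul_one, mul_zero,
        Finset.sum_ite_eq', Finset.mem_univ, if_true]
      ring
    simp only [h2] at h1
    simp only [zero_add, zero_mul, add_zero, smul_eq_mul]
    have h3 : ∑ i, y i ^ q = μ * ∑ j, x j ^ q := hxμ
    rw [h3]
    refine mul_nonneg (inv_nonneg.2 ht0.le) ?_
    linarith
  have h4 : ∑ k, δ k * q * x k ^ (q - 1) = q * x j ^ (q - 1) := by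
    simp [hδ]
  have h5 : ∑ i, a i j * q * y i ^ (q - 1) = q * ∑ i, a i j * y i ^ (q - 1) := by
    rw [Finset.mul_sum]
    exact Finset.sum_congr rfl fun i _ => by ring
  rw [h4, h5] at hnn
  refine le_of_mul_le_mul_left ?_ (show 0 < q by linarith)
  linarith

/-- Let `x` maximise the `ℓ^q` norm of `a z` on the nonnegative unit sphere, with maximum `μ < 1` of
its `q`-th power. The pair `x`, `a x` satisfies the first condition with equality and the second
with the factor `μ` to spare; a slight dilation of `a x` makes both strict. -/
theorem exists_strict_subinvariant [Nonempty K] (hq : 1 < q) {a : K → K → ℝ}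
    (ha : ∀ i j, 0 < a i j) {r : ℝ} (hr : r < 1)
    (h : ∀ z : K → ℝ, (∀ j, 0 ≤ z j) → ∑ i, (∑ j, a i j * z j) ^ q ≤ r * ∑ j, z j ^ q) :
    ∃ x y : K → ℝ, (∀ j, 0 < x j) ∧ (∀ i, 0 < y i) ∧ (∀ i, ∑ j, a i j * x j < y i) ∧
      ∀ j, ∑ i, a i j * y i ^ (q - 1) < x j ^ (q - 1) := by
  classical
  have hq0 : 0 < q := by linarith
  set S : Set (K → ℝ) := {z | (∀ j, 0 ≤ z j) ∧ ∑ j, z j ^ q = 1} with hS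
  have cpow : ∀ j, Continuous fun z : K → ℝ => z j ^ q := fun j =>
    (continuous_apply j).rpow_const fun _ => Or.inr hq0.le
  have hSc : IsCompact S := by
    refine (isCompact_univ_pi fun _ => isCompact_Icc (a := (0 : ℝ)) (b := 1)).of_isClosed_subset ?_ ?_
    · have : S = (⋂ j, {z : K → ℝ | 0 ≤ z j}) ∩ {z | ∑ j, z j ^ q = 1} := by
        ext z; simp [hS]
      rw [this]
      exact (isClosed_iInter fun j => isClosed_le continuous_const (continuous_apply j)).inter
        (isClosed_eq (continuous_finsetSum _ fun j _ => cpow j) continuous_const)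
    · rintro z ⟨hz0, hz1⟩ j -
      refine ⟨hz0 j, ?_⟩
      by_contra! hc
      have h1 : 1 < z j ^ q := Real.one_lt_rpow hc hq0
      have h2 : z j ^ q ≤ ∑ j, z j ^ q := Finset.single_le_sum (f := fun j => z j ^ q)
        (fun k _ => Real.rpow_nonneg (hz0 k) _) (Finset.mem_univ j)
      linarith
  have hSne : S.Nonempty := by
    obtain ⟨j⟩ := ‹Nonempty K›
    refine ⟨Pi.single j 1, fun k => ?_, ?_⟩
    · by_cases hk : k = j
      · subst hk; simp
      · simp [hk]
    · rw [Finset.sum_eq_single j]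
      · simp
      · intro k _ hk
        simp [hk, Real.zero_rpow hq0.ne']
      · simp
  have cF : Continuous fun z : K → ℝ => ∑ i, (∑ j, a i j * z j) ^ q := by
    refine continuous_finsetSum _ fun i _ => Continuous.rpow_const ?_ fun _ => Or.inr hq0.le
    fun_prop
  obtain ⟨x, ⟨hx0, hx1⟩, hmax⟩ := hSc.exists_isMaxOn hSne cF.continuousOn
  set μ := ∑ i, (∑ j, a i j * x j) ^ q with hμ
  have hμz : ∀ z : K → ℝ, (∀ j, 0 ≤ z j) → ∑ i, (∑ j, a i j * z j) ^ q ≤ μ * ∑ j, z j ^ q := by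
    intro z hz
    rcases (Finset.sum_nonneg fun j _ => Real.rpow_nonneg (hz j) q).eq_or_lt with h0 | h0
    · have := h z hz
      rw [← h0, mul_zero] at this ⊢
      exact this
    · set s := ∑ j, z j ^ q with hs
      set c := s ^ (-q⁻¹) with hc
      have hc0 : 0 < c := Real.rpow_pos_of_pos h0 _
      have hcq : c ^ q = s⁻¹ := by
        rw [hc, ← Real.rpow_mul h0.le, neg_mul, inv_mul_cancel₀ hq0.ne', Real.rpow_neg_one]
      have hcz : (fun j => c * z j) ∈ S := by
        refine ⟨fun j => mul_nonneg hc0.le (hz j), ?_⟩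
        simp only [Real.mul_rpow hc0.le (hz _)]
        rw [← Finset.mul_sum, hcq, inv_mul_cancel₀ h0.ne']
      have h1 := hmax hcz
      simp only [mem_ofPred_eq] at h1
      have h2 : ∀ i, (∑ j, a i j * (c * z j)) ^ q = s⁻¹ * (∑ j, a i j * z j) ^ q := fun i => by
        rw [← hcq, ← Real.mul_rpow hc0.le
          (Finset.sum_nonneg fun j _ => mul_nonneg (ha i j).le (hz j)), Finset.mul_sum]
        congr 1
        exact Finset.sum_congr rfl fun j _ => by ring
      simp only [h2, ← Finset.mul_sum] at h1
      rwa [inv_mul_le_iff₀ h0, mul_comm] at h1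
  have hxpos : ∃ j, 0 < x j := by
    by_contra! hc
    have : ∀ j, x j = 0 := fun j => le_antisymm (hc j) (hx0 j)
    simp [this, Real.zero_rpow hq0.ne'] at hx1
  set y : K → ℝ := fun i => ∑ j, a i j * x j with hy
  have hypos : ∀ i, 0 < y i := fun i => by
    obtain ⟨j, hj⟩ := hxpos
    exact Finset.sum_pos' (fun k _ => mul_nonneg (ha i k).le (hx0 k))
      ⟨j, Finset.mem_univ j, mul_pos (ha i j) hj⟩
  have hμ0 : 0 < μ := Finset.sum_pos (fun i _ => Real.rpow_pos_of_pos (hypos i) _)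
    Finset.univ_nonempty
  have hμ1 : μ < 1 := by
    have := h x hx0
    rw [hx1, mul_one] at this
    linarith
  have hcol := sum_mul_rpow_le_of_isMax hq hμz hx0
    (by rw [hx1, mul_one])
  -- A zero coordinate would make the right side of the optimality condition vanish, while its left
  -- side is positive because all entries are.
  have hxp : ∀ j, 0 < x j := fun j => by
    refine (hx0 j).lt_of_ne' fun h0 => ?_
    have h1 := hcol j
    rw [h0, Real.zero_rpow (by linarith), mul_zero] at h1
    exact absurd h1 (not_le.2 (Finset.sum_pos (fun i _ => mul_pos (ha i j)
      (Real.rpow_pos_of_pos (hypos i) _)) Finset.univ_nonempty))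
  -- This dilation exceeds 1, and `s ^ (q - 1) * μ = μ ^ (1/q)` is still below 1.
  set s := μ ^ (-q⁻¹) with hs
  have hs1 : 1 < s := Real.one_lt_rpow_of_pos_of_lt_one_of_neg hμ0 hμ1 (by simpa using hq0)
  have hs0 : 0 < s := by linarith
  have hsμ : s ^ (q - 1) * μ < 1 := by
    have : s ^ (q - 1) * μ = μ ^ q⁻¹ := by
      rw [hs, ← Real.rpow_mul hμ0.le]
      nth_rw 2 [← Real.rpow_one μ]
      rw [← Real.rpow_add hμ0]
      congr 1
      field_simp
      ring
    rw [this]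
    exact Real.rpow_lt_one hμ0.le hμ1 (inv_pos.2 hq0)
  refine ⟨x, fun i => s * y i, hxp, fun i => mul_pos hs0 (hypos i), fun i => ?_, fun j => ?_⟩
  · exact lt_mul_of_one_lt_left (hypos i) hs1
  · have h1 : ∑ i, a i j * (s * y i) ^ (q - 1) = s ^ (q - 1) * ∑ i, a i j * y i ^ (q - 1) := by
      rw [Finset.mul_sum]
      refine Finset.sum_congr rfl fun i _ => ?_
      rw [Real.mul_rpow hs0.le (hypos i).le]
      ring
    rw [h1]
    have h2 : 0 < x j ^ (q - 1) := Real.rpow_pos_of_pos (hxp j) _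
    calc s ^ (q - 1) * ∑ i, a i j * y i ^ (q - 1) ≤ s ^ (q - 1) * (μ * x j ^ (q - 1)) := by
          gcongr; exact hcol j
      _ = (s ^ (q - 1) * μ) * x j ^ (q - 1) := by ring
      _ < 1 * x j ^ (q - 1) := by gcongr
      _ = x j ^ (q - 1) := one_mul _

end Matrix

/-! ### Averages over fine partitions converge strongly to the identity -/

section AverageTendsto

variable {p : ℝ≥0∞} [Fact (1 ≤ p)] {K : Type*} [Fintype K]

/-- On each piece the average of `g` is within its oscillation `η` of `g`; the pieces recombine
because the lengths sum to 1. -/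
theorem norm_sub_average_le (hp' : p ≠ ∞) {w : K → ℝ} {θ : K → unitInterval → unitInterval}
    (h : IsTiling w θ) {ι ρ : K → Op p} (hs : IsSystem w ι ρ) (hw : ∑ k, w k = 1)
    (hρ : ∀ k f, ∀ᵐ t, ρ k f t = ((w k ^ p.toReal⁻¹ : ℝ) : ℂ) * f (θ k t))
    (g : C(unitInterval, ℂ)) {η : ℝ} (hη : 0 ≤ η)
    (hg : ∀ k s t, ‖g (θ k s) - g (θ k t)‖ ≤ η) :
    ‖ContinuousMap.toLp p volume ℂ g - average ι ρ (ContinuousMap.toLp p volume ℂ g)‖ ≤ η := by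
  have hq := toReal_pos' hp'
  set f : LpI p := ContinuousMap.toLp p volume ℂ g with hf
  have hfg : ∀ᵐ x, f x = g x := ContinuousMap.coeFn_toLp volume g
  have hk : ∀ k, ‖ρ k (f - average ι ρ f)‖ ≤ w k ^ p.toReal⁻¹ * η := by
    intro k
    have hc : 0 ≤ w k ^ p.toReal⁻¹ := Real.rpow_nonneg (h.pos k).le _
    have hρf : ∀ᵐ t, ρ k f t = ((w k ^ p.toReal⁻¹ : ℝ) : ℂ) * g (θ k t) := by
      filter_upwards [hρ k f, h.ae_iff.1 hfg k] with t h1 h2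
      rw [h1, h2]
    have hi : Integrable fun t => g (θ k t) :=
      h.integrable_iff.1 ((integrable_coeFn f).congr hfg) k
    have hm : mean p (ρ k f) = ((w k ^ p.toReal⁻¹ : ℝ) : ℂ) * ∫ t, g (θ k t) := by
      rw [mean_apply, integral_congr_ae hρf, integral_const_mul]
    rw [map_sub, average_apply, hs.ρ_sum, avg_apply, hm]
    have hb : ∀ᵐ t, ‖(ρ k f - (((w k ^ p.toReal⁻¹ : ℝ) : ℂ) * ∫ t, g (θ k t)) • one p : LpI p) t‖ ≤
        w k ^ p.toReal⁻¹ * η := by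
      filter_upwards [Lp.coeFn_sub (ρ k f) ((((w k ^ p.toReal⁻¹ : ℝ) : ℂ) * ∫ t, g (θ k t)) • one p),
        Lp.coeFn_smul (((w k ^ p.toReal⁻¹ : ℝ) : ℂ) * ∫ t, g (θ k t)) (one p), coeFn_one p, hρf]
        with t h1 h2 h3 h4
      rw [h1, Pi.sub_apply, h2, Pi.smul_apply, h3, h4, smul_eq_mul, mul_one, ← mul_sub, norm_mul,
        Complex.norm_real, Real.norm_of_nonneg hc]
      refine mul_le_mul_of_nonneg_left ?_ hc
      have : g (θ k t) - ∫ s, g (θ k s) = ∫ s, (g (θ k t) - g (θ k s)) := by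
        rw [integral_sub (integrable_const _) hi]; simp
      rw [this]
      simpa using norm_integral_le_of_norm_le_const (μ := (volume : Measure unitInterval))
        (Eventually.of_forall fun s => hg k t s)
    simpa [measureUnivNNReal] using Lp.norm_le_of_ae_bound (mul_nonneg hc hη) hb
  rw [← Real.rpow_le_rpow_iff (norm_nonneg _) hη hq, ← hs.sum_norm]
  calc ∑ k, ‖ρ k (f - average ι ρ f)‖ ^ p.toReal ≤ ∑ k, w k * η ^ p.toReal := by
        refine Finset.sum_le_sum fun k _ => ?_
        refine (Real.rpow_le_rpow (norm_nonneg _) (hk k) hq.le).trans (le_of_eq ?_)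
        rw [Real.mul_rpow (Real.rpow_nonneg (h.pos k).le _) hη, ← Real.rpow_mul (h.pos k).le,
          inv_mul_cancel₀ hq.ne', Real.rpow_one]
    _ = η ^ p.toReal := by rw [← Finset.sum_mul, hw, one_mul]

theorem exists_average_tendsto (hp' : p ≠ ∞) :
    ∃ (w : ∀ n : ℕ, Fin (n + 1) → ℝ) (ι ρ : ∀ n : ℕ, Fin (n + 1) → Op p),
      (∀ n, IsSystem (w n) (ι n) (ρ n)) ∧
      ∀ f, Tendsto (fun n => average (ι n) (ρ n) f) atTop (𝓝 f) := by
  have hw : ∀ n : ℕ, ∑ _k : Fin (n + 1), (1 / ((n : ℝ) + 1)) = 1 := fun n => by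
    simp only [Finset.sum_const, Finset.card_univ, Fintype.card_fin, nsmul_eq_mul]
    push_cast
    field_simp
  choose θ hθ using fun n : ℕ => exists_isTiling (K := Fin (n + 1)) (fun _ => 1 / ((n : ℝ) + 1))
    (fun _ => by positivity) (hw n)
  choose ι ρ hs hρ using fun n => (hθ n).exists_isSystem hp'
  refine ⟨_, ι, ρ, hs, fun f => ?_⟩
  rw [Metric.tendsto_atTop]
  intro ε hε
  obtain ⟨g, hg⟩ := (ContinuousMap.toLp_denseRange (α := unitInterval) ℂ volume ℂ
    hp').exists_dist_lt f (show 0 < ε / 3 by linarith)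
  rw [dist_eq_norm] at hg
  have hu := CompactSpace.uniformContinuous_of_continuous g.continuous
  obtain ⟨δ, hδ, hδg⟩ := Metric.uniformContinuous_iff.1 hu (ε / 4) (by linarith)
  obtain ⟨N, hN⟩ := exists_nat_one_div_lt hδ
  refine ⟨N, fun n hn => ?_⟩
  have hmesh : (1 : ℝ) / (n + 1) < δ := lt_of_le_of_lt (by gcongr) hN
  have h1 := norm_sub_average_le hp' (hθ n) (hs n) (hw n) (hρ n) g (η := ε / 4) (by linarith)
    fun k s t => by
      rw [← dist_eq_norm]
      refine (hδg (lt_of_le_of_lt ((hθ n).lip k s t) (lt_of_le_of_lt ?_ hmesh))).le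
      refine mul_le_of_le_one_right (by positivity) ?_
      rw [Subtype.dist_eq, Real.dist_eq, abs_le]
      constructor <;> linarith [s.2.1, s.2.2, t.2.1, t.2.2]
  have h2 := ((hs n).average_mem hp').2 (f - ContinuousMap.toLp p volume ℂ g)
  rw [map_sub] at h2
  set G : LpI p := ContinuousMap.toLp p volume ℂ g
  rw [dist_comm, dist_eq_norm]
  calc ‖f - average (ι n) (ρ n) f‖
      = ‖(f - G) + (G - average (ι n) (ρ n) G) -
          (average (ι n) (ρ n) f - average (ι n) (ρ n) G)‖ := by congr 1; abel
    _ ≤ ‖(f - G) + (G - average (ι n) (ρ n) G)‖ +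
          ‖average (ι n) (ρ n) f - average (ι n) (ρ n) G‖ := norm_sub_le _ _
    _ ≤ ‖f - G‖ + ‖G - average (ι n) (ρ n) G‖ +
          ‖average (ι n) (ρ n) f - average (ι n) (ρ n) G‖ := by gcongr; exact norm_add_le _ _
    _ < ε := by linarith

end AverageTendsto

/-! ### Realising a positive matrix by an invertible isometry -/

section Approximation

variable {p : ℝ≥0∞} [Fact (1 ≤ p)]

theorem one_mem_positiveInvertibleIsometries : (1 : Op p) ∈ positiveInvertibleIsometries p :=
  ⟨fun _ hf => hf, fun _ => rfl, fun f => ⟨f, rfl⟩⟩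

/-- There are positive invertible isometries whose value at the constant function `1` has
arbitrarily small integral. -/
theorem exists_norm_mean_one_lt (hp : 1 < p) (hp' : p ≠ ∞) {ε : ℝ} (hε : 0 < ε) :
    ∃ W ∈ positiveInvertibleIsometries p, ‖mean p (W (one p))‖ < ε := by
  have hq := one_lt_toReal hp hp'
  set q := p.toReal
  have hq1 : 0 < 1 - q⁻¹ := sub_pos.2 (inv_lt_one_of_one_lt₀ hq)
  have hq2 : 0 < q⁻¹ := by positivity
  -- `F d` is the mean of the image of `1` when pieces of lengths `d` and `1 - d` are exchanged; it
  -- tends to 0 with `d`.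
  set F : ℝ → ℝ := fun d => d ^ (1 - q⁻¹) * (1 - d) ^ q⁻¹ + (1 - d) ^ (1 - q⁻¹) * d ^ q⁻¹ with hF
  have hFc : ContinuousAt F 0 := by
    have c1 : ∀ r : ℝ, 0 < r → Continuous fun d : ℝ => d ^ r := fun r hr =>
      continuous_id.rpow_const fun _ => Or.inr hr.le
    have c2 : ∀ r : ℝ, 0 < r → Continuous fun d : ℝ => (1 - d) ^ r := fun r hr =>
      (continuous_const.sub continuous_id).rpow_const fun _ => Or.inr hr.le
    exact (((c1 _ hq1).mul (c2 _ hq2)).add ((c2 _ hq1).mul (c1 _ hq2))).continuousAt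
  have hF0 : F 0 = 0 := by
    simp [hF, Real.zero_rpow hq1.ne', Real.zero_rpow hq2.ne']
  have hev : ∀ᶠ d in 𝓝[>] (0 : ℝ), F d < ε ∧ d < 1 ∧ 0 < d := by
    have e1 : ∀ᶠ d in 𝓝 (0 : ℝ), F d < ε := hFc.eventually (gt_mem_nhds (by rwa [hF0]))
    have e2 : ∀ᶠ d in 𝓝 (0 : ℝ), d < 1 := gt_mem_nhds zero_lt_one
    filter_upwards [nhdsWithin_le_nhds e1, nhdsWithin_le_nhds e2, self_mem_nhdsWithin]
      with d h1 h2 h3 using ⟨h1, h2, h3⟩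
  obtain ⟨d, hd, hd1, hd0⟩ := hev.exists
  obtain ⟨ι, ρ, h⟩ := exists_isSystem hp' (fun b : Bool => if b then d else 1 - d)
    (fun b => by cases b <;> simp [hd0, hd1]) (by simp)
  refine ⟨_, h.sum_mem hp' (h.reindex Equiv.boolNot)
    (fun _ => one_mem_positiveInvertibleIsometries), ?_⟩
  have e : mean p ((∑ k, ι k ∘L 1 ∘L (ρ ∘ Equiv.boolNot) k) (one p)) = (F d : ℂ) := by
    simp [hF, h.ρ_one, h.mean_ι, mean_one]
    ring
  rw [e, Complex.norm_real, Real.norm_of_nonneg]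
  · exact hd
  · have : 0 < 1 - d := by linarith
    positivity

variable {K : Type*} [Fintype K] {w : K → ℝ} {ι ρ : K → Op p}

/-- The compression of `T` to step functions depends on `T` only through its matrix of means. -/
theorem average_average (ι ρ : K → Op p) (T : Op p) (f : LpI p) :
    average ι ρ (T (average ι ρ f)) =
      ∑ i, ι i ((∑ j, mean p (ρ j f) * mean p (ρ i (T (ι j (one p))))) • one p) := by
  rw [average_apply]
  refine Finset.sum_congr rfl fun i _ => ?_
  rw [avg_apply, average_apply]
  simp only [map_sum, avg_apply, map_smul, smul_eq_mul]

theorem norm_sum_smul_le (h : IsSystem w ι ρ) (hp' : p ≠ ∞) (c : K → ℂ) :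
    ‖∑ i, ι i (c i • one p)‖ ≤ ∑ i, ‖c i‖ := by
  refine (norm_sum_le _ _).trans (Finset.sum_le_sum fun i _ => ?_)
  rw [h.norm_ι hp', norm_smul, norm_one, mul_one]

/-- Exchange of the two indices of a piece of a subdivision, leaving the remainders in place. -/
def swapIndex : K × Option K → K × Option K
  | (i, some j) => (j, some i)
  | (i, none) => (i, none)

omit [Fintype K] in
theorem swapIndex_involutive : Function.Involutive (swapIndex (K := K)) := by
  rintro ⟨i, _ | j⟩ <;> rfl

/-- Test `T` on the step function with coefficients `z`; taking the mean on each piece does not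
increase the norm, so the matrix inherits the operator bound. -/
theorem sum_rpow_entries_le (h : IsSystem w ι ρ) (hp' : p ≠ ∞) {T : Op p} {a : K → K → ℝ}
    (ha : ∀ i j, 0 < a i j) (haT : ∀ i j, mean p (ρ i (T (ι j (one p)))) = a i j)
    {r : ℝ} (hT : ∀ f, ‖T f‖ ^ p.toReal ≤ r * ‖f‖ ^ p.toReal) (z : K → ℝ) (hz : ∀ j, 0 ≤ z j) :
    ∑ i, (∑ j, a i j * z j) ^ p.toReal ≤ r * ∑ j, z j ^ p.toReal := by
  have hu := hT (∑ j, ι j ((z j : ℂ) • one p))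
  rw [h.norm_sum] at hu
  have h1 : ∀ j, ‖(z j : ℂ) • one p‖ ^ p.toReal = z j ^ p.toReal := fun j => by
    rw [norm_smul, norm_one, mul_one, Complex.norm_real, Real.norm_of_nonneg (hz j)]
  simp only [h1] at hu
  refine le_trans ?_ hu
  rw [← h.sum_norm (T _)]
  refine Finset.sum_le_sum fun i _ => Real.rpow_le_rpow
    (Finset.sum_nonneg fun j _ => mul_nonneg (ha i j).le (hz j)) ?_ (toReal_pos' hp').le
  refine le_trans (le_of_eq ?_) (norm_mean_le p _)
  have h2 : mean p (ρ i (T (∑ j, ι j ((z j : ℂ) • one p)))) = ((∑ j, a i j * z j : ℝ) : ℂ) := by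
    simp only [map_sum, map_smul, smul_eq_mul, haT]
    push_cast
    exact Finset.sum_congr rfl fun j _ => mul_comm _ _
  rw [h2, Complex.norm_real, Real.norm_of_nonneg
    (Finset.sum_nonneg fun j _ => mul_nonneg (ha i j).le (hz j))]

/-- The isometry from a subpiece of proportion `u` of one piece onto a subpiece of proportion `v` of
another has matrix entry `v ^ (1 - 1/q) * u ^ (1/q)`. With the proportions chosen here, `x` and `y`
cancel. -/
theorem coefficient_rpow {q a x y : ℝ} (hq : 1 < q) (ha : 0 < a) (hx : 0 < x) (hy : 0 < y) :
    (a * x / y) ^ (1 - q⁻¹) * (a * y ^ (q - 1) / x ^ (q - 1)) ^ q⁻¹ = a := by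
  have e : (q - 1) * q⁻¹ = 1 - q⁻¹ := by field_simp
  rw [Real.div_rpow (by positivity) hy.le, Real.mul_rpow ha.le hx.le,
    Real.div_rpow (by positivity) (by positivity), Real.mul_rpow ha.le (by positivity),
    ← Real.rpow_mul hy.le, ← Real.rpow_mul hx.le, e]
  have h1 : a ^ (1 - q⁻¹) * a ^ q⁻¹ = a := by
    rw [← Real.rpow_add ha, sub_add_cancel, Real.rpow_one]
  have h2 : 0 < x ^ (1 - q⁻¹) := by positivity
  have h3 : 0 < y ^ (1 - q⁻¹) := by positivity
  generalize x ^ (1 - q⁻¹) = X at *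
  generalize y ^ (1 - q⁻¹) = Y at *
  generalize a ^ (1 - q⁻¹) = A at *
  generalize a ^ q⁻¹ = B at *
  field_simp
  exact h1

theorem exists_option_system (hp' : p ≠ ∞) {v : K → ℝ} (hv : ∀ j, 0 < v j) (hv1 : ∑ j, v j < 1) :
    ∃ ι ρ : Option K → Op p, IsSystem (fun o => o.elim (1 - ∑ j, v j) v) ι ρ := by
  refine exists_isSystem hp' _ ?_ ?_
  · rintro (_ | j)
    · exact sub_pos.2 hv1
    · exact hv j
  · rw [Fintype.sum_option]
    simp

theorem exists_approx [Nonempty K] (hp : 1 < p) (hp' : p ≠ ∞) (h : IsSystem w ι ρ) {T : Op p}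
    {a : K → K → ℝ} (ha : ∀ i j, 0 < a i j)
    (haT : ∀ i j, mean p (ρ i (T (ι j (one p)))) = a i j)
    {r : ℝ} (hr : r < 1) (hT : ∀ f, ‖T f‖ ^ p.toReal ≤ r * ‖f‖ ^ p.toReal)
    {ε : ℝ} (hε : 0 < ε) :
    ∃ U ∈ positiveInvertibleIsometries p, ∀ f,
      ‖average ι ρ (U (average ι ρ f)) - average ι ρ (T (average ι ρ f))‖ ≤ ε * ‖f‖ := by
  classical
  have hq := one_lt_toReal hp hp'
  obtain ⟨x, y, hx, hy, hrow, hcol⟩ := exists_strict_subinvariant hq ha hr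
    (sum_rpow_entries_le h hp' ha haT hT)
  have hyq : ∀ j, 0 < y j ^ (p.toReal - 1) := fun j => Real.rpow_pos_of_pos (hy j) _
  have hxq : ∀ j, 0 < x j ^ (p.toReal - 1) := fun j => Real.rpow_pos_of_pos (hx j) _
  -- `κ i` cuts piece `i` of the range and, below, `l j` cuts piece `j` of the domain. The strict
  -- inequalities for `x` and `y` leave a leftover of positive length, indexed by `none`, in every
  -- piece.
  choose κ κ' hκ using fun i => exists_option_system (p := p) (v := fun j => a i j * x j / y i) hp'
    (fun j => div_pos (mul_pos (ha i j) (hx j)) (hy i))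
    (by rw [← Finset.sum_div, div_lt_one (hy i)]; exact hrow i)
  choose l l' hl using fun j => exists_option_system (p := p)
    (v := fun i => a i j * y i ^ (p.toReal - 1) / x j ^ (p.toReal - 1)) hp'
    (fun i => div_pos (mul_pos (ha i j) (hyq i)) (hxq j))
    (by rw [← Finset.sum_div, div_lt_one (hxq j)]; exact hcol j)
  -- The leftovers perturb only the diagonal entries, one per piece; dividing by the number of
  -- pieces makes the total error at most `ε ‖f‖`.
  obtain ⟨W, hW, hWε⟩ := exists_norm_mean_one_lt hp hp'
    (show 0 < ε / Fintype.card K from div_pos hε (by exact_mod_cast Fintype.card_pos))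
  let V : K × Option K → Op p := fun io => io.2.elim W fun _ => 1
  have hV : ∀ io, V io ∈ positiveInvertibleIsometries p := by
    rintro ⟨i, _ | j⟩
    · exact hW
    · exact one_mem_positiveInvertibleIsometries
  set c : K → ℝ := fun i => (1 - ∑ j, a i j * x j / y i) ^ (1 - p.toReal⁻¹) *
    (1 - ∑ k, a k i * y k ^ (p.toReal - 1) / x i ^ (p.toReal - 1)) ^ p.toReal⁻¹ with hc
  have hc1 : ∀ i, |c i| ≤ 1 := fun i => by
    have h1 : 0 < 1 - ∑ j, a i j * x j / y i := (hκ i).pos none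
    have h2 : 0 < 1 - ∑ k, a k i * y k ^ (p.toReal - 1) / x i ^ (p.toReal - 1) := (hl i).pos none
    have h3 : 0 ≤ ∑ j, a i j * x j / y i :=
      Finset.sum_nonneg fun j _ => (div_pos (mul_pos (ha i j) (hx j)) (hy i)).le
    have h4 : 0 ≤ ∑ k, a k i * y k ^ (p.toReal - 1) / x i ^ (p.toReal - 1) :=
      Finset.sum_nonneg fun k _ => (div_pos (mul_pos (ha k i) (hyq k)) (hxq i)).le
    rw [abs_of_nonneg (by positivity)]
    refine mul_le_one₀ (Real.rpow_le_one h1.le (by linarith)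
      (sub_nonneg.2 (inv_le_one_of_one_le₀ hq.le))) (by positivity)
      (Real.rpow_le_one h2.le (by linarith) (by positivity))
  set U : Op p := ∑ io : K × Option K, (ι io.1 ∘L κ io.1 io.2) ∘L V io ∘L
    ((fun kj : K × Option K => l' kj.1 kj.2 ∘L ρ kj.1) ∘ swapIndex_involutive.toPerm) io with hU
  refine ⟨U, (h.comp hκ).sum_mem hp' ((h.comp hl).reindex swapIndex_involutive.toPerm) hV, ?_⟩
  have hUij : ∀ i j, mean p (ρ i (U (ι j (one p)))) =
      a i j + if i = j then (c i : ℂ) * mean p (W (one p)) else 0 := by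
    intro i j
    have e1 : U (ι j (one p)) = ∑ k, ι k (∑ o : Option K, κ k o (V (k, o)
        (l' (swapIndex (k, o)).1 (swapIndex (k, o)).2 (ρ (swapIndex (k, o)).1 (ι j (one p)))))) := by
      rw [hU, sum_apply, Fintype.sum_prod_type]
      simp [map_sum]
    rw [e1, h.ρ_sum, Fintype.sum_option, map_add, add_comm]
    congr 1
    · rw [map_sum, Finset.sum_eq_single j]
      · simp only [swapIndex, V, Option.elim_some, h.ρ_ι_self, (hl j).ρ_one, map_smul,
          one_apply_eq_self, (hκ i).mean_ι, mean_one, smul_eq_mul, mul_one]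
        rw [← Complex.ofReal_mul, mul_comm, coefficient_rpow hq (ha i j) (hx j) (hy i)]
      · intro k _ hk
        simp [swapIndex, h.ρ_ι_ne k j hk]
      · simp
    · by_cases hij : i = j
      · subst hij
        simp only [swapIndex, V, Option.elim_none, h.ρ_ι_self, (hl i).ρ_one, map_smul,
          (hκ i).mean_ι, smul_eq_mul, if_true, hc]
        push_cast
        ring
      · simp [swapIndex, h.ρ_ι_ne i j hij, hij]
  intro f
  rw [average_average, average_average, ← Finset.sum_sub_distrib]
  have e2 : ∀ i, ι i ((∑ j, mean p (ρ j f) * mean p (ρ i (U (ι j (one p))))) • one p) -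
      ι i ((∑ j, mean p (ρ j f) * mean p (ρ i (T (ι j (one p))))) • one p) =
      ι i ((mean p (ρ i f) * ((c i : ℂ) * mean p (W (one p)))) • one p) := fun i => by
    rw [← map_sub, ← sub_smul, ← Finset.sum_sub_distrib]
    congr 2
    simp only [← mul_sub, hUij, haT, add_sub_cancel_left, mul_ite, mul_zero,
      Finset.sum_ite_eq, Finset.mem_univ, if_true]
  simp only [e2]
  refine (norm_sum_smul_le h hp' _).trans ?_
  calc ∑ i, ‖mean p (ρ i f) * ((c i : ℂ) * mean p (W (one p)))‖
      ≤ ∑ _i : K, ‖f‖ * (1 * (ε / Fintype.card K)) := by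
        refine Finset.sum_le_sum fun i _ => ?_
        rw [norm_mul, norm_mul, Complex.norm_real, Real.norm_eq_abs]
        exact mul_le_mul ((norm_mean_le p _).trans (h.norm_ρ_le hp' i f))
          (mul_le_mul (hc1 i) hWε.le (norm_nonneg _) zero_le_one) (by positivity) (norm_nonneg _)
    _ = ε * ‖f‖ := by
        rw [Finset.sum_const, Finset.card_univ, nsmul_eq_mul]
        field_simp

end Approximation

/-! ### Weak density of the invertible isometries -/

section Density

variable {p : ℝ≥0∞} [Fact (1 ≤ p)]

theorem norm_apply_sub_compress_le {E S : Op p} (hE : ∀ f, ‖E f‖ ≤ ‖f‖) (hS : ∀ f, ‖S f‖ ≤ ‖f‖)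
    (φ : StrongDual ℂ (LpI p)) (f : LpI p) :
    ‖φ (S f) - φ (E (S (E f)))‖ ≤ ‖φ - φ ∘L E‖ * ‖f‖ + ‖φ‖ * ‖f - E f‖ := by
  have e : φ (S f) - φ (E (S (E f))) = (φ - φ ∘L E) (S f) + φ (E (S (f - E f))) := by
    simp
  rw [e]
  refine (norm_add_le _ _).trans (add_le_add ?_ ?_)
  · exact ((φ - φ ∘L E).le_opNorm _).trans (by gcongr; exact hS f)
  · exact (φ.le_opNorm _).trans (by gcongr; exact (hE _).trans (hS _))

/-- A convex combination of `T`, `0` and the projection onto the constants. -/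
noncomputable def perturb (T : Op p) (d : ℝ) : Op p :=
  ((1 - 2 * d : ℝ) : ℂ) • T + (d : ℂ) • avg p

theorem perturb_apply (T : Op p) (d : ℝ) (f : LpI p) :
    perturb T d f = ((1 - 2 * d : ℝ) : ℂ) • T f + (d : ℂ) • avg p f := rfl

theorem norm_perturb_le {T : Op p} (hT : ∀ f, ‖T f‖ ≤ ‖f‖) {d : ℝ} (hd : 0 ≤ d) (hd' : 2 * d ≤ 1)
    (f : LpI p) : ‖perturb T d f‖ ≤ (1 - d) * ‖f‖ := by
  rw [perturb_apply]
  refine (norm_add_le _ _).trans ?_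
  rw [norm_smul, norm_smul, Complex.norm_real, Complex.norm_real, Real.norm_of_nonneg hd,
    Real.norm_of_nonneg (by linarith)]
  have h1 := mul_le_mul_of_nonneg_left (hT f) (show 0 ≤ 1 - 2 * d by linarith)
  have h2 := mul_le_mul_of_nonneg_left (norm_avg_le p f) hd
  linarith

theorem norm_perturb_sub_le {T : Op p} (hT : ∀ f, ‖T f‖ ≤ ‖f‖) {d : ℝ} (hd : 0 ≤ d) (f : LpI p) :
    ‖perturb T d f - T f‖ ≤ 3 * d * ‖f‖ := by
  have e : perturb T d f - T f = (d : ℂ) • (avg p f - (2 : ℂ) • T f) := by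
    rw [perturb_apply]
    push_cast
    module
  rw [e, norm_smul, Complex.norm_real, Real.norm_of_nonneg hd]
  have h1 : ‖avg p f - (2 : ℂ) • T f‖ ≤ ‖f‖ + 2 * ‖f‖ := by
    refine (norm_sub_le _ _).trans (add_le_add (norm_avg_le p f) ?_)
    rw [norm_smul, RCLike.norm_ofNat]
    gcongr
    exact hT f
  have := mul_le_mul_of_nonneg_left h1 hd
  linarith

/-- `T` contributes nonnegative entries by positivity, and the projection onto constants adds a
strictly positive amount to each. -/
theorem exists_entries_perturb {K : Type*} [Fintype K] {w : K → ℝ} {ι ρ : K → Op p}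
    (h : IsSystem w ι ρ) {T : Op p} (hT : IsPositive T) {d : ℝ} (hd : 0 < d) (hd' : 2 * d ≤ 1) :
    ∃ a : K → K → ℝ, (∀ i j, 0 < a i j) ∧
      ∀ i j, mean p (ρ i (perturb T d (ι j (one p)))) = a i j := by
  have h1 : ∀ᵐ x, 0 ≤ one p x := by
    filter_upwards [coeFn_one p] with x hx
    rw [hx]; exact zero_le_one
  have h2 : ∀ i j, 0 ≤ mean p (ρ i (T (ι j (one p)))) := fun i j =>
    mean_nonneg (h.pos_ρ i _ (hT _ (h.pos_ι j _ h1)))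
  refine ⟨fun i j => (1 - 2 * d) * (mean p (ρ i (T (ι j (one p))))).re +
    d * (w j ^ (1 - p.toReal⁻¹) * w i ^ p.toReal⁻¹), fun i j => ?_, fun i j => ?_⟩
  · refine add_pos_of_nonneg_of_pos (mul_nonneg (by linarith) (Complex.nonneg_iff.1 (h2 i j)).1) ?_
    have := h.pos i
    have := h.pos j
    positivity
  · have h3 : mean p (ρ i (T (ι j (one p)))) = ((mean p (ρ i (T (ι j (one p))))).re : ℂ) :=
      Complex.eq_re_of_ofReal_le (r := 0) (by simpa using h2 i j)
    rw [perturb_apply, map_add, map_add, map_smul, map_smul, map_smul, map_smul, avg_apply,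
      map_smul, map_smul, h.ρ_one, map_smul, h.mean_ι, mean_one, h3]
    simp only [smul_eq_mul]
    push_cast
    ring

/-- Every positive contraction is a limit of positive invertible isometries in the weak operator
topology. -/
theorem exists_tendsto_weak (hp : 1 < p) (hp' : p ≠ ∞) {T : Op p}
    (hT : T ∈ positiveContractions p) :
    ∃ U : ℕ → Op p, (∀ n, U n ∈ positiveInvertibleIsometries p) ∧
      ∀ f (φ : StrongDual ℂ (LpI p)), Tendsto (fun n => φ (U n f)) atTop (𝓝 (φ (T f))) := by
  have hq := toReal_pos' hp'
  obtain ⟨w, ι, ρ, hs, hE⟩ := exists_average_tendsto (p := p) hp'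
  -- One null sequence serves both as the size of the perturbation and as the tolerance of
  -- `exists_approx`; the shift ensures `2 * d n ≤ 1` already at `n = 0`.
  set d : ℕ → ℝ := fun n => 1 / ((n : ℝ) + 3) with hd
  have hd0 : ∀ n, 0 < d n := fun n => by positivity
  have hd1 : ∀ n, 2 * d n ≤ 1 := fun n => by
    rw [hd]
    have : (0 : ℝ) ≤ n := n.cast_nonneg
    rw [mul_one_div, div_le_one (by positivity)]
    linarith
  choose a ha haT using fun n => exists_entries_perturb (hs n) hT.1 (hd0 n) (hd1 n)
  have hr : ∀ n, (1 - d n) ^ p.toReal < 1 := fun n =>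
    Real.rpow_lt_one (by linarith [hd0 n, hd1 n]) (by linarith [hd0 n]) hq
  have hTr : ∀ n f, ‖perturb T (d n) f‖ ^ p.toReal ≤ (1 - d n) ^ p.toReal * ‖f‖ ^ p.toReal :=
    fun n f => by
      rw [← Real.mul_rpow (by linarith [hd0 n, hd1 n]) (norm_nonneg _)]
      exact Real.rpow_le_rpow (norm_nonneg _) (norm_perturb_le hT.2 (hd0 n).le (hd1 n) f) hq.le
  choose U hU hUE using fun n => exists_approx hp hp' (hs n) (ha n) (haT n) (hr n) (hTr n) (hd0 n)
  refine ⟨U, hU, fun f φ => ?_⟩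
  set E : ℕ → Op p := fun n => average (ι n) (ρ n)
  have hEc : ∀ n f, ‖E n f‖ ≤ ‖f‖ := fun n => ((hs n).average_mem hp').2
  -- The averages tend strongly to the identity, an invertible isometry, so their adjoints converge
  -- strongly too.
  have hEφ : Tendsto (fun n => ‖φ - φ ∘L E n‖) atTop (𝓝 0) := by
    have h1 := tendsto_comp_of_weak (l := atTop) hp hp' (u := E) (T := 1) hEc φ le_rfl
      (fun _ => le_rfl) fun f => (φ.continuous.tendsto _).comp (hE f)
    have h2 := (tendsto_const_nhds (x := φ)).sub h1
    have h3 : φ - φ ∘L (1 : Op p) = 0 := by ext; simp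
    rw [h3] at h2
    simpa using h2.norm
  have hEf : Tendsto (fun n => ‖f - E n f‖) atTop (𝓝 0) := by
    simpa using ((tendsto_const_nhds (x := f)).sub (hE f)).norm
  have hdl : Tendsto d atTop (𝓝 0) := by
    have := (tendsto_one_div_add_atTop_nhds_zero_nat (𝕜 := ℝ)).comp (tendsto_add_atTop_nat 2)
    refine this.congr fun n => ?_
    simp only [Function.comp, hd]
    push_cast
    ring_nf
  rw [tendsto_iff_norm_sub_tendsto_zero]
  refine squeeze_zero (fun _ => norm_nonneg _) (g := fun n => 2 * (‖φ - φ ∘L E n‖ * ‖f‖ +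
    ‖φ‖ * ‖f - E n f‖) + 4 * d n * (‖φ‖ * ‖f‖)) (fun n => ?_) ?_
  · have h1 := norm_apply_sub_compress_le (hEc n) (fun f => ((hU n).2.1 f).le) φ f
    have h2 := norm_apply_sub_compress_le (hEc n) (S := perturb T (d n)) (fun f =>
      (norm_perturb_le hT.2 (hd0 n).le (hd1 n) f).trans
        (mul_le_of_le_one_left (norm_nonneg _) (by linarith [hd0 n]))) φ f
    have h3 : ‖φ (E n (U n (E n f)) - E n (perturb T (d n) (E n f)))‖ ≤ ‖φ‖ * (d n * ‖f‖) :=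
      (φ.le_opNorm _).trans (by gcongr; exact hUE n f)
    have h4 : ‖φ (perturb T (d n) f - T f)‖ ≤ ‖φ‖ * (3 * d n * ‖f‖) :=
      (φ.le_opNorm _).trans (by gcongr; exact norm_perturb_sub_le hT.2 (hd0 n).le f)
    -- Pass from `U n` to its compression, then to that of the perturbed operator, then to the
    -- perturbed operator itself, and finally to `T`.
    have e : φ (U n f) - φ (T f) = ((φ (U n f) - φ (E n (U n (E n f)))) +
        φ (E n (U n (E n f)) - E n (perturb T (d n) (E n f))) -
        (φ (perturb T (d n) f) - φ (E n (perturb T (d n) (E n f))))) +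
        φ (perturb T (d n) f - T f) := by
      simp only [map_sub]; ring
    rw [e]
    refine (norm_add_le _ _).trans ?_
    refine (add_le_add_left ((norm_sub_le _ _).trans (add_le_add_left (norm_add_le _ _) _)) _).trans ?_
    linarith
  · have := (((hEφ.mul_const ‖f‖).add (hEf.const_mul ‖φ‖)).const_mul 2).add
      ((hdl.const_mul 4).mul_const (‖φ‖ * ‖f‖))
    simpa using this

end Density

/-! ### Continuity points and the `G_δ` property -/

section Topologies

variable {p : ℝ≥0∞} [Fact (1 ≤ p)]

theorem nhds_onC (τ : TopologicalSpace (Op p)) (T : positiveContractions p) :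
    @nhds _ (onC τ) T = comap Subtype.val (@nhds _ τ T.1) := by
  rw [nhds_induced]

theorem tendsto_wot_iff {α : Type*} {l : Filter α} {u : α → Op p} {T : Op p} :
    Tendsto u l (@nhds _ (wot p) T) ↔
      ∀ f (φ : StrongDual ℂ (LpI p)), Tendsto (fun i => φ (u i f)) l (𝓝 (φ (T f))) := by
  rw [nhds_induced, tendsto_comap_iff, tendsto_pi_nhds, Prod.forall]
  rfl

theorem tendsto_sot_iff {α : Type*} {l : Filter α} {u : α → Op p} {T : Op p} :
    Tendsto u l (@nhds _ (sot p) T) ↔ ∀ f, Tendsto (fun i => u i f) l (𝓝 (T f)) := by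
  rw [nhds_induced, tendsto_comap_iff, tendsto_pi_nhds]
  rfl

theorem tendsto_sotStar_iff {α : Type*} {l : Filter α} {u : α → Op p} {T : Op p} :
    Tendsto u l (@nhds _ (sotStar p) T) ↔ (∀ f, Tendsto (fun i => u i f) l (𝓝 (T f))) ∧
      ∀ φ : StrongDual ℂ (LpI p), Tendsto (fun i => φ ∘L u i) l (𝓝 (φ ∘L T)) := by
  rw [sotStar, nhds_inf (t₁ := sot p) (t₂ := sotAdj p), tendsto_inf, tendsto_sot_iff]
  refine and_congr_right fun _ => ?_
  rw [nhds_induced, tendsto_comap_iff, tendsto_pi_nhds]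
  rfl

theorem mem_contPoints_iff {τ₁ τ₂ : TopologicalSpace (Op p)} {T : Op p} :
    T ∈ contPoints τ₁ τ₂ ↔ ∃ hT : T ∈ positiveContractions p,
      Tendsto (Subtype.val : positiveContractions p → Op p)
        (@nhds _ (onC τ₁) ⟨T, hT⟩) (@nhds _ τ₂ T) := by
  refine exists_congr fun hT => ?_
  have e : @ContinuousAt (positiveContractions p) (positiveContractions p) (onC τ₁) (onC τ₂) id
      ⟨T, hT⟩ ↔ Tendsto id (@nhds _ (onC τ₁) ⟨T, hT⟩) (@nhds _ (onC τ₂) ⟨T, hT⟩) := Iff.rfl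
  rw [e, nhds_onC τ₂, tendsto_comap_iff]
  rfl

theorem tendsto_apply_onC_wot (T : positiveContractions p) (f : LpI p)
    (φ : StrongDual ℂ (LpI p)) :
    Tendsto (fun S : positiveContractions p => φ (S.1 f)) (@nhds _ (onC (wot p)) T)
      (𝓝 (φ (T.1 f))) := by
  refine tendsto_wot_iff.1 ?_ f φ
  rw [nhds_onC]
  exact tendsto_comap

theorem tendsto_sot_of_isometry (hp : 1 < p) (hp' : p ≠ ∞) (T : positiveContractions p)
    (hT : ∀ f, ‖T.1 f‖ = ‖f‖) (f : LpI p) :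
    Tendsto (fun S : positiveContractions p => S.1 f) (@nhds _ (onC (wot p)) T) (𝓝 (T.1 f)) :=
  tendsto_of_weak_of_norm_le hp hp'
    (Eventually.of_forall fun S => by rw [hT]; exact S.2.2 f) fun φ => tendsto_apply_onC_wot T f φ

theorem exists_seq_onC_wot (hp : 1 < p) (hp' : p ≠ ∞) (T : positiveContractions p) :
    ∃ U : ℕ → positiveContractions p, (∀ n, (U n).1 ∈ positiveInvertibleIsometries p) ∧
      Tendsto U atTop (@nhds _ (onC (wot p)) T) := by
  obtain ⟨U, hU, hUT⟩ := exists_tendsto_weak hp hp' T.2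
  refine ⟨fun n => ⟨U n, mem_contractions_of_isometry ⟨(hU n).1, (hU n).2.1⟩⟩, hU, ?_⟩
  rw [nhds_onC, tendsto_comap_iff]
  exact tendsto_wot_iff.2 hUT

/-- Invertible isometries converging weakly to `T` converge strongly by hypothesis, and norms pass
to strong limits. -/
theorem norm_eq_of_tendsto_sot (hp : 1 < p) (hp' : p ≠ ∞) (T : positiveContractions p)
    (h : ∀ f, Tendsto (fun S : positiveContractions p => S.1 f) (@nhds _ (onC (wot p)) T)
      (𝓝 (T.1 f))) (f : LpI p) : ‖T.1 f‖ = ‖f‖ := by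
  obtain ⟨U, hU, hUT⟩ := exists_seq_onC_wot hp hp' T
  refine tendsto_nhds_unique (((h f).comp hUT).norm) ?_
  simp only [Function.comp_apply, (hU _).2.1]
  exact tendsto_const_nhds

theorem contPoints_wot_sot (hp : 1 < p) (hp' : p ≠ ∞) :
    contPoints (wot p) (sot p) = positiveIsometries p := by
  ext T
  rw [mem_contPoints_iff]
  constructor
  · rintro ⟨hT, h⟩
    exact ⟨hT.1, norm_eq_of_tendsto_sot hp hp' ⟨T, hT⟩ (tendsto_sot_iff.1 h)⟩
  · intro hT
    exact ⟨mem_contractions_of_isometry hT,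
      tendsto_sot_iff.2 (tendsto_sot_of_isometry hp hp' ⟨T, _⟩ hT.2)⟩

theorem contPoints_wot_sotStar (hp : 1 < p) (hp' : p ≠ ∞) :
    contPoints (wot p) (sotStar p) = positiveInvertibleIsometries p := by
  ext T
  rw [mem_contPoints_iff]
  constructor
  · rintro ⟨hT, h⟩
    obtain ⟨h1, h2⟩ := tendsto_sotStar_iff.1 h
    have hi := norm_eq_of_tendsto_sot hp hp' ⟨T, hT⟩ h1
    refine ⟨hT.1, hi, surjective_of_isometry_of_comp hi fun φ => ?_⟩
    obtain ⟨U, hU, hUT⟩ := exists_seq_onC_wot hp hp' ⟨T, hT⟩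
    exact ge_of_tendsto (((h2 φ).comp hUT).norm) (Eventually.of_forall fun n =>
      norm_le_norm_comp_of_surjective (hU n).2.1 (hU n).2.2 φ)
  · intro hT
    have hc := mem_contractions_of_isometry ⟨hT.1, hT.2.1⟩
    exact ⟨hc, tendsto_sotStar_iff.2 ⟨tendsto_sot_of_isometry hp hp' ⟨T, hc⟩ hT.2.1, fun φ =>
      tendsto_comp_of_weak hp hp' (u := fun S : positiveContractions p => S.1) (fun S => S.2.2) φ
        (norm_le_norm_comp_of_surjective hT.2.1 hT.2.2 φ) hc.2
        fun f => tendsto_apply_onC_wot ⟨T, hc⟩ f φ⟩⟩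

theorem dense_invertible (hp : 1 < p) (hp' : p ≠ ∞) :
    @Dense (positiveContractions p) (onC (wot p))
      (Subtype.val ⁻¹' positiveInvertibleIsometries p) := by
  let _ := onC (wot p)
  intro T
  obtain ⟨U, hU, hUT⟩ := exists_seq_onC_wot hp hp' T
  exact mem_closure_of_tendsto hUT (Eventually.of_forall hU)

/-- Weak lower semicontinuity of the norm, seen through a norming functional of `T f`. -/
theorem isOpen_lt_norm (f : LpI p) (c : ℝ) :
    IsOpen[onC (wot p)] {T : positiveContractions p | c < ‖T.1 f‖} := by
  let _ := onC (wot p)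
  rw [isOpen_iff_mem_nhds]
  intro T hT
  obtain ⟨φ, hφ, hφf⟩ := exists_dual_vector'' ℂ (T.1 f)
  have h := (tendsto_apply_onC_wot T f φ).norm
  rw [hφf, RCLike.norm_ofReal, abs_norm] at h
  filter_upwards [h.eventually (lt_mem_nhds hT)] with S hS
  exact hS.trans_le ((φ.le_opNorm _).trans (mul_le_of_le_one_left (norm_nonneg _) hφ))

theorem isGδ_isometries (hp' : p ≠ ∞) :
    @IsGδ (positiveContractions p) (onC (wot p)) (Subtype.val ⁻¹' positiveIsometries p) := by
  have : Fact (p ≠ ∞) := ⟨hp'⟩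
  let _ := onC (wot p)
  obtain ⟨D, hDc, hD⟩ := TopologicalSpace.exists_countable_dense (LpI p)
  have e : (Subtype.val ⁻¹' positiveIsometries p : Set (positiveContractions p)) =
      ⋂ f ∈ D, ⋂ n : ℕ, {T | ‖f‖ - 1 / ((n : ℝ) + 1) < ‖T.1 f‖} := by
    ext T
    simp only [mem_preimage, mem_iInter]
    constructor
    · intro hT f _ n
      have : 0 < 1 / ((n : ℝ) + 1) := by positivity
      change _ < ‖T.1 f‖
      rw [hT.2 f]
      linarith
    · intro h
      refine ⟨T.2.1, fun f => ?_⟩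
      have hcl : IsClosed {f : LpI p | ‖T.1 f‖ = ‖f‖} :=
        isClosed_eq T.1.continuous.norm continuous_norm
      refine hcl.closure_subset_iff.2 (fun g hg => ?_) (hD f)
      refine le_antisymm (T.2.2 g) (le_of_forall_pos_lt_add fun ε hε => ?_)
      obtain ⟨n, hn⟩ := exists_nat_one_div_lt hε
      have : ‖g‖ - 1 / ((n : ℝ) + 1) < ‖T.1 g‖ := h g hg n
      linarith
  rw [e]
  exact IsGδ.biInter hDc fun f _ => IsGδ.iInter fun n => (isOpen_lt_norm f _).isGδ

theorem isGδ_invertible (hp : 1 < p) (hp' : p ≠ ∞) :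
    @IsGδ (positiveContractions p) (onC (wot p))
      (Subtype.val ⁻¹' positiveInvertibleIsometries p) := by
  have : Fact (p ≠ ∞) := ⟨hp'⟩
  let _ := onC (wot p)
  obtain ⟨D, hDc, hD⟩ := TopologicalSpace.exists_countable_dense (LpI p)
  have e : (Subtype.val ⁻¹' positiveInvertibleIsometries p : Set (positiveContractions p)) =
      Subtype.val ⁻¹' positiveIsometries p ∩ ⋂ g ∈ D, ⋂ n : ℕ,
        -- Taking interiors makes the sets weakly open without further argument. An invertible
        -- isometry lies in the interior because the identity map is continuous there from the weak
        -- to the strong topology. Conversely, an isometry has closed range, so approximating a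
        -- dense set of `g` gives surjectivity.
        interior {T | ∃ f, ‖T.1 f - g‖ < 1 / ((n : ℝ) + 1)} := by
    ext T
    simp only [mem_preimage, mem_inter_iff, mem_iInter]
    constructor
    · intro hT
      refine ⟨⟨hT.1, hT.2.1⟩, fun g _ n => ?_⟩
      obtain ⟨f, hf⟩ := hT.2.2 g
      have h := ((tendsto_sot_of_isometry hp hp' T hT.2.1 f).sub_const g).norm
      rw [hf, sub_self, norm_zero] at h
      rw [mem_interior_iff_mem_nhds]
      filter_upwards [h.eventually (gt_mem_nhds (show 0 < 1 / ((n : ℝ) + 1) by positivity))]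
        with S hS using ⟨f, hS⟩
    · rintro ⟨hT, h⟩
      refine ⟨hT.1, hT.2, fun g => ?_⟩
      have hi : Isometry T.1 := AddMonoidHomClass.isometry_of_norm T.1 hT.2
      have hcl : IsClosed (range T.1) := hi.isClosedEmbedding.isClosed_range
      refine hcl.closure_subset_iff.2 (fun g hg => ?_) (hD g)
      rw [← hcl.closure_eq, Metric.mem_closure_range_iff]
      intro ε hε
      obtain ⟨n, hn⟩ := exists_nat_one_div_lt hε
      obtain ⟨f, hf⟩ := interior_subset (h g hg n)
      exact ⟨f, by rw [dist_comm, dist_eq_norm]; exact hf.trans hn⟩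
  rw [e]
  exact (isGδ_isometries hp').inter (IsGδ.biInter hDc fun f _ => IsGδ.iInter fun n =>
    isOpen_interior.isGδ)

end Topologies

end PosOp

theorem mainTheorem7 (p : ℝ≥0∞) [Fact (1 ≤ p)] (hp : 1 < p) (hp' : p ≠ ∞) :
    PosOp.contPoints (PosOp.wot p) (PosOp.sot p) = PosOp.positiveIsometries p ∧
    PosOp.contPoints (PosOp.wot p) (PosOp.sotStar p) = PosOp.positiveInvertibleIsometries p ∧
    PosOp.IsDenseGδIn (PosOp.wot p) (PosOp.positiveIsometries p) ∧
    PosOp.IsDenseGδIn (PosOp.wot p) (PosOp.positiveInvertibleIsometries p) := by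
  refine ⟨PosOp.contPoints_wot_sot hp hp', PosOp.contPoints_wot_sotStar hp hp',
    ⟨fun T hT => PosOp.mem_contractions_of_isometry hT, ?_, PosOp.isGδ_isometries hp'⟩,
    ⟨fun T hT => PosOp.mem_contractions_of_isometry ⟨hT.1, hT.2.1⟩,
      PosOp.dense_invertible hp hp', PosOp.isGδ_invertible hp hp'⟩⟩
  let _ := PosOp.onC (PosOp.wot p)
  exact (PosOp.dense_invertible hp hp').mono fun T hT => ⟨hT.1, hT.2.1⟩
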